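/- Let $\mathcal S$ be the unit sphere in $\mathbb R^3$ and let $\mathcal C\subset\mathcal S$ be a simple closed curve made of finitely many regular $C^2$ arcs (corners are allowed, cusps are not). Suppose $\mathcal C$ divides $\mathcal S$ into two disjoint open parts $\mathcal S_1,\mathcal S_2$ with $\mathcal S\setminus\mathcal C=\mathcal S_1\cup\mathcal S_2$ and $\partial\mathcal S_1=\partial\mathcal S_2=\mathcal C$. Let $\vec t$ be the unit tangent of $\mathcal C$ oriented in accordance with $\mathcal S_2$ (seen from outside the sphere, $\mathcal S_2$ lies to the left of $\mathcal C$). Put $$U^*(x,y)=-\frac1{4\pi}\log|1-\langle x,y\rangle|,\qquad \underline{\mathrm{curl}}_{\mathcal S}f(y)=\nabla_{\mathcal S}f(y)\times y ,$$ and, for a continuous density $\mu:\mathcal C\to\mathbb R$, define the double layer potential $$(\widetilde W\mu)(x)=\int_{\mathcal C}\mu(y)\,\big[\underline{\mathrm{curl}}_{\mathcal S,y}U^*(x,y)\cdot\vec t(y)\big]\,ds_y,\qquad x\in\mathcal S\setminus\mathcal C .$$ Let $x_0\in\mathcal C$ and let $\alpha(x_0)\in(0,2\pi)$ be the interior angle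 of $\mathcal C$ at $x_0$ with respect to $\mathcal S_2$. Then: 1. The principal value $$(K\mu)(x_0)=\lim_{\varepsilon\to0^+}\int_{\{y\in\mathcal C:\,|y-x_0|\ge\varepsilon\}}\mu(y)\,\big[\underline{\mathrm{curl}}_{\mathcal S,y}U^*(x_0,y)\cdot\vec t(y)\big]\,ds_y$$ exists. 2. The one-sided limit from $\mathcal S_2$ exists and $$(\gamma_0^{\mathcal S_2}\widetilde W\mu)(x_0):=\lim_{\mathcal S_2\ni x\to x_0}(\widetilde W\mu)(x)=(K\mu)(x_0)+\Big(1-\frac{\alpha(x_0)}{2\pi}\Big)\mu(x_0).$$ 3. If the unit tangent is continuous at $x_0$, then $\alpha(x_0)=\pi$. 4. The one-sided limit $(\gamma_0^{\mathcal S_1}\widetilde W\mu)(x_0)$ from $\mathcal S_1$ of the double layer potential formed with the tangent oriented in accordance with $\mathcal S_1$, that is, with $-\vec t$ in place of $\vec t$, exists, and $$(\gamma_0^{\mathcal S_2}\widetilde W\mu)(x_0)+(\gamma_0^{\mathcal S_1}\widetilde W\mu)(x_0)=\mu(x_0).$$ -/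

import Mathlib

open Filter Topology MeasureTheory Set

noncomputable section

/-- Euclidean three-space. -/
abbrev E3 : Type := EuclideanSpace ℝ (Fin 3)

/-- The unit sphere in Euclidean three-space. -/
abbrev Sphere2 : Type := Metric.sphere (0 : E3) 1

/-- The cross product on Euclidean three-space. -/
def cross (u v : E3) : E3 := WithLp.toLp 2 (crossProduct u.ofLp v.ofLp)

/-- Surface gradient at `y ∈ Sphere2` of a function given on the sphere: the Euclidean gradient of
its extension that is constant along rays, which is
`(1 / sin θ) ∂f/∂φ e_φ + ∂f/∂θ e_θ` in spherical coordinates. -/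
def surfaceGradient (f : E3 → ℝ) (y : E3) : E3 :=
  gradient (fun z : E3 => f (‖z‖⁻¹ • z)) y

/-- Vectorial surface rotation `∇_S f × e_r`, which is
`-∂f/∂θ e_φ + (1 / sin θ) ∂f/∂φ e_θ` in spherical coordinates. -/
def surfaceCurl (f : E3 → ℝ) (y : E3) : E3 :=
  cross (surfaceGradient f y) y

/-- Fundamental solution of the Laplace-Beltrami operator on the unit sphere. -/
def fundamentalSolution (x y : E3) : ℝ :=
  -(1 / (4 * Real.pi)) * Real.log |1 - inner ℝ x y|

/-- Unit tangent of a path at `s` on the side of larger parameters. -/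
def rightTangent (c : ℝ → E3) (s : ℝ) : E3 :=
  ‖derivWithin c (Ici s) s‖⁻¹ • derivWithin c (Ici s) s

/-- Unit tangent of a path at `s` on the side of smaller parameters
(pointing in the direction of increasing parameter). -/
def leftTangent (c : ℝ → E3) (s : ℝ) : E3 :=
  ‖derivWithin c (Iic s) s‖⁻¹ • derivWithin c (Iic s) s

/-- A piecewise `C²` simple closed curve on the unit sphere, made of `N ≥ 1` regular `C²` arcs (each
parametrized by an interval between consecutive integers), possibly with corners, but without
cusps. The parametrization is extended to `ℝ` with period `N`. -/
structure SphereCurve where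
  /-- The number of arcs. -/
  N : ℕ
  N_pos : 0 < N
  /-- The parametrization. -/
  pt : ℝ → Sphere2
  periodic : Function.Periodic pt (N : ℝ)
  injOn : InjOn pt (Ico 0 (N : ℝ))
  contDiffOn : ∀ k : ℤ, ContDiffOn ℝ 2 (fun s => (pt s : E3)) (Icc (k : ℝ) (k + 1))
  regular : ∀ k : ℤ, ∀ s ∈ Icc (k : ℝ) (k + 1),
    derivWithin (fun s => (pt s : E3)) (Icc (k : ℝ) (k + 1)) s ≠ 0
  no_cusp : ∀ s : ℝ,
    rightTangent (fun s => (pt s : E3)) s ≠ -leftTangent (fun s => (pt s : E3)) s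

namespace SphereCurve

/-- The parametrization as a path in Euclidean space. -/
def path (C : SphereCurve) (s : ℝ) : E3 := (C.pt s : E3)

/-- The curve as a subset of the sphere. -/
def carrier (C : SphereCurve) : Set Sphere2 := range C.pt

/-- The unit tangent vector along the curve (at a corner, that of the outgoing arc). -/
def tangent (C : SphereCurve) (s : ℝ) : E3 := rightTangent C.path s

/-- The curve divides the sphere into the two parts `S₁` and `S₂`, and it is the boundary of each
of them. -/
structure Divides (C : SphereCurve) (S₁ S₂ : Set Sphere2) : Prop where
  isOpen_fst : IsOpen S₁
  isOpen_snd : IsOpen S₂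
  disjoint : Disjoint S₁ S₂
  union_eq : S₁ ∪ S₂ = C.carrierᶜ
  frontier_fst : frontier S₁ = C.carrier
  frontier_snd : frontier S₂ = C.carrier

/-- The curve is positively oriented with respect to the region `D`, as in Stokes' theorem: seen
from outside the sphere, `D` lies to the left of the curve. At every point `y` interior to an
arc, with unit tangent `t`, the points of the sphere next to `y` in the direction `y × t`
belong to `D`. -/
def PositivelyOriented (C : SphereCurve) (D : Set Sphere2) : Prop :=
  ∀ s : ℝ, (∀ k : ℤ, s ≠ k) → ∀ᶠ δ in 𝓝[>] (0 : ℝ), ∃ z ∈ D,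
    (z : E3) = ‖C.path s + δ • cross (C.path s) (C.tangent s)‖⁻¹ •
      (C.path s + δ • cross (C.path s) (C.tangent s))

/-- The angle in `[0, 2π)` by which, at the point `x₀ = C.pt s`, the outgoing tangent direction
has to be turned to the left in the tangent plane in order to reach the reversed incoming
tangent direction. It is the interior angle of the region to the left of the curve. -/
def interiorAngle (C : SphereCurve) (s : ℝ) : ℝ :=
  toIcoMod Real.two_pi_pos 0 (Complex.arg
    ⟨inner ℝ (rightTangent C.path s) (-leftTangent C.path s),
      inner ℝ (cross (C.path s) (rightTangent C.path s)) (-leftTangent C.path s)⟩)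

/-- Line integral with respect to arc length over the part of the curve whose parameter lies in
`A`. -/
def lineIntegral (C : SphereCurve) (A : Set ℝ) (f : ℝ → ℝ) : ℝ :=
  ∫ s in Ioc 0 (C.N : ℝ) ∩ A, f s * ‖deriv C.path s‖

/-- The integrand `μ(y) [curl_S U*(x, y) · t(y)]` at `y = C.pt s`, with the surface rotation taken
in the variable `y`, for a unit tangent field `t` along the curve. -/
def doubleLayerIntegrand (C : SphereCurve) (t : ℝ → E3) (μ : Sphere2 → ℝ) (x : Sphere2)
    (s : ℝ) : ℝ :=
  μ (C.pt s) * inner ℝ (surfaceCurl (fundamentalSolution (x : E3)) (C.path s)) (t s)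

/-- The double layer potential with density `μ`, for the unit tangent field `t`. -/
def doubleLayer (C : SphereCurve) (t : ℝ → E3) (μ : Sphere2 → ℝ) (x : Sphere2) : ℝ :=
  C.lineIntegral univ (C.doubleLayerIntegrand t μ x)

/-- The truncated operator: the integral over the points of the curve at distance at least `ε`
from `x₀`. -/
def truncK (C : SphereCurve) (t : ℝ → E3) (μ : Sphere2 → ℝ) (x₀ : Sphere2) (ε : ℝ) : ℝ :=
  C.lineIntegral {s | ε ≤ ‖C.path s - (x₀ : E3)‖} (C.doubleLayerIntegrand t μ x₀)

/-- The principal value operator `K`. -/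
def K (C : SphereCurve) (t : ℝ → E3) (μ : Sphere2 → ℝ) (x₀ : Sphere2) : ℝ :=
  limUnder (𝓝[>] (0 : ℝ)) (C.truncK t μ x₀)

end SphereCurve

/-- The one-sided trace at `x₀` of a function, taken from the region `D`. -/
def trace (D : Set Sphere2) (u : Sphere2 → ℝ) (x₀ : Sphere2) : ℝ :=
  limUnder (𝓝[D] x₀) u

end

/-!
The kernel is `⟪x × y, t⟫ / (2π ‖x - y‖²)`. By comparison with the Poisson kernel, its `L¹` norm
along a regular piece of the curve is bounded uniformly in `x`. So the principal value is an
absolutely convergent integral, the potential of a density that vanishes at `x₀` is continuous at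
`x₀`, and the jump at `x₀` is that of the constant density `μ(x₀)` on an arbitrarily short piece of
the curve.

In the stereographic chart `ζ` centred at `x₀` the kernel, times the arc length element, becomes
`Im (dζ / (ζ - ζ(x))) / 2π` minus a term that does not depend on `x`. Hence the integral of the
difference of the kernels at `x` and at `x₀` compares the change of `arg (ζ - ζ(x))` along the piece
with the change of `arg ζ` along its two halves. The piece is a graph over the real axis, with
one-sided tangents of arguments `θ₋` and `θ₊` at `x₀`. So this integral tends to
`(θ₊ - θ₋ ± π) / 2π` when `x` tends to `x₀` from above or below the graph, and the interior angle is
`π - θ₊ + θ₋`.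
-/

noncomputable section

open scoped RealInnerProductSpace ComplexConjugate

/-! ### Vector algebra -/

theorem inner_eq_sum_coord (u v : E3) : ⟪u, v⟫ = u 0 * v 0 + u 1 * v 1 + u 2 * v 2 := by
  simp only [PiLp.inner_apply, Fin.sum_univ_three, RCLike.inner_apply, conj_trivial]
  ring

theorem cross_apply_zero (u v : E3) : cross u v 0 = u 1 * v 2 - u 2 * v 1 := by
  simp [cross, cross_apply]

theorem cross_apply_one (u v : E3) : cross u v 1 = u 2 * v 0 - u 0 * v 2 := by
  simp [cross, cross_apply]

theorem cross_apply_two (u v : E3) : cross u v 2 = u 0 * v 1 - u 1 * v 0 := by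
  simp [cross, cross_apply]

theorem cross_self_eq_zero (u : E3) : cross u u = 0 := by
  simp [cross]

theorem cross_smul_left (r : ℝ) (u v : E3) : cross (r • u) v = r • cross u v := by
  simp [cross]

theorem cross_smul_right (r : ℝ) (u v : E3) : cross u (r • v) = r • cross u v := by
  simp [cross]

theorem cross_sub_left (u v w : E3) : cross (u - v) w = cross u w - cross v w := by
  simp [cross]

theorem cross_cross_eq (u v w : E3) : cross u (cross v w) = ⟪u, w⟫ • v - ⟪u, v⟫ • w := by
  ext i
  fin_cases i <;>
  simp only [Fin.zero_eta, Fin.mk_one, Fin.reduceFinMk, cross_apply_zero, cross_apply_one,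
    cross_apply_two, inner_eq_sum_coord, PiLp.sub_apply, PiLp.smul_apply, smul_eq_mul] <;>
  ring

theorem inner_cross_rotate (u v w : E3) : ⟪cross u v, w⟫ = ⟪cross v w, u⟫ := by
  simp only [inner_eq_sum_coord, cross_apply_zero, cross_apply_one, cross_apply_two]
  ring

theorem inner_cross_left_self (u v : E3) : ⟪cross u v, u⟫ = 0 := by
  rw [inner_cross_rotate, inner_cross_rotate, cross_self_eq_zero, inner_zero_left]

theorem inner_cross_right_self (u v : E3) : ⟪cross u v, v⟫ = 0 := by
  rw [inner_cross_rotate, cross_self_eq_zero, inner_zero_left]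

theorem inner_cross_cross (u v w z : E3) :
    ⟪cross u v, cross w z⟫ = ⟪u, w⟫ * ⟪v, z⟫ - ⟪u, z⟫ * ⟪v, w⟫ := by
  rw [inner_cross_rotate, real_inner_comm, cross_cross_eq, inner_sub_right, inner_smul_right,
    inner_smul_right]
  ring

theorem norm_cross_le (u v : E3) : ‖cross u v‖ ≤ ‖u‖ * ‖v‖ := by
  refine le_of_sq_le_sq ?_ (by positivity)
  rw [← real_inner_self_eq_norm_sq, inner_cross_cross, mul_pow, ← real_inner_self_eq_norm_sq,
    ← real_inner_self_eq_norm_sq, real_inner_comm u v]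
  nlinarith only [sq_nonneg ⟪u, v⟫]

theorem abs_inner_cross_le (u v w : E3) : |⟪cross u v, w⟫| ≤ ‖u‖ * ‖v‖ * ‖w‖ :=
  (abs_real_inner_le_norm _ _).trans
    (mul_le_mul_of_nonneg_right (norm_cross_le u v) (norm_nonneg w))

theorem continuous_cross : Continuous fun p : E3 × E3 => cross p.1 p.2 := by
  refine (PiLp.continuous_toLp 2 _).comp (continuous_pi fun i => ?_)
  fin_cases i <;> simp only [cross_apply] <;> fun_prop

/-- The triple `(a, c × a, c)` is a positively oriented orthonormal frame; it serves to identify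
the tangent plane of the sphere at `c` with `ℂ`. -/
structure IsFrame (a c : E3) : Prop where
  norm_fst : ‖a‖ = 1
  norm_snd : ‖c‖ = 1
  inner_eq_zero : ⟪c, a⟫ = 0

/-- The component of a vector orthogonal to `c`, as the complex number formed by its coordinates
along `a` and `c × a`. -/
def frameCoord (a c : E3) : E3 →L[ℝ] ℂ :=
  (innerSL ℝ a).smulRight (1 : ℂ) + (innerSL ℝ (cross c a)).smulRight Complex.I

theorem frameCoord_re (a c v : E3) : (frameCoord a c v).re = ⟪a, v⟫ := by
  simp [frameCoord]

theorem frameCoord_im (a c v : E3) : (frameCoord a c v).im = ⟪cross c a, v⟫ := by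
  simp [frameCoord]

namespace IsFrame

variable {a c : E3}

theorem inner_fst_self (h : IsFrame a c) : ⟪a, a⟫ = 1 := by
  rw [real_inner_self_eq_norm_sq, h.norm_fst, one_pow]

theorem inner_snd_self (h : IsFrame a c) : ⟪c, c⟫ = 1 := by
  rw [real_inner_self_eq_norm_sq, h.norm_snd, one_pow]

theorem norm_cross (h : IsFrame a c) : ‖cross c a‖ = 1 := by
  rw [← sq_eq_sq₀ (norm_nonneg _) zero_le_one, ← real_inner_self_eq_norm_sq, inner_cross_cross,
    h.inner_fst_self, h.inner_snd_self, h.inner_eq_zero]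
  ring

theorem cross_cross_snd (h : IsFrame a c) : cross (cross c a) c = a := by
  have key : cross (cross c a) c = -cross c (cross c a) := by
    simp only [cross, WithLp.ofLp_toLp, ← WithLp.toLp_neg, cross_anticomm]
  rw [key, cross_cross_eq, h.inner_eq_zero, h.inner_snd_self]
  simp

theorem cross_fst_cross (h : IsFrame a c) : cross a (cross c a) = c := by
  rw [cross_cross_eq, h.inner_fst_self, real_inner_comm, h.inner_eq_zero]
  simp

theorem orthonormal (h : IsFrame a c) : Orthonormal ℝ ![a, cross c a, c] := by
  have hac : ⟪a, c⟫ = 0 := by rw [real_inner_comm, h.inner_eq_zero]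
  refine ⟨fun i => ?_, fun i j hij => ?_⟩
  · fin_cases i <;> simp [h.norm_fst, h.norm_snd, h.norm_cross]
  · fin_cases i <;> fin_cases j <;>
      simp [h.inner_eq_zero, hac, inner_cross_left_self, inner_cross_right_self,
        real_inner_comm (cross c a)] at hij ⊢

theorem inner_eq (h : IsFrame a c) (u v : E3) :
    ⟪u, v⟫ = ⟪a, u⟫ * ⟪a, v⟫ + ⟪cross c a, u⟫ * ⟪cross c a, v⟫ + ⟪u, c⟫ * ⟪v, c⟫ := by
  have hcard : Fintype.card (Fin 3) = Module.finrank ℝ E3 := by simp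
  have hbasis := coe_basisOfOrthonormalOfCardEqFinrank h.orthonormal hcard
  have parseval := ((basisOfOrthonormalOfCardEqFinrank h.orthonormal hcard).toOrthonormalBasis
    (by rw [hbasis]; exact h.orthonormal)).sum_inner_mul_inner u v
  simp only [Module.Basis.coe_toOrthonormalBasis, hbasis, Fin.sum_univ_three, Matrix.cons_val_zero,
    Matrix.cons_val_one, Matrix.cons_val] at parseval
  rw [← parseval, real_inner_comm a u, real_inner_comm (cross c a) u, real_inner_comm v c]

theorem conj_frameCoord_mul (h : IsFrame a c) (u v : E3) :
    conj (frameCoord a c u) * frameCoord a c v =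
      ⟨⟪u, v⟫ - ⟪u, c⟫ * ⟪v, c⟫, ⟪cross u v, c⟫⟩ := by
  apply Complex.ext
  · rw [Complex.mul_re, Complex.conj_re, Complex.conj_im, frameCoord_re, frameCoord_re,
      frameCoord_im, frameCoord_im, h.inner_eq u v]
    ring
  · rw [Complex.mul_im, Complex.conj_re, Complex.conj_im, frameCoord_re, frameCoord_re,
      frameCoord_im, frameCoord_im]
    nth_rw 5 [← h.cross_fst_cross]
    rw [inner_cross_cross, real_inner_comm a u, real_inner_comm a v,
      real_inner_comm (cross c a) u, real_inner_comm (cross c a) v]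
    ring

theorem frameCoord_cross (h : IsFrame a c) (u v : E3) :
    frameCoord a c (cross u v) =
      Complex.I * (⟪u, c⟫ * frameCoord a c v - ⟪v, c⟫ * frameCoord a c u) := by
  apply Complex.ext
  · nth_rw 1 [frameCoord_re, ← h.cross_cross_snd, inner_cross_cross]
    simp [frameCoord_im, real_inner_comm c]
    ring
  · rw [frameCoord_im, inner_cross_cross]
    simp [frameCoord_re, real_inner_comm c]

end IsFrame

section InnerProductSpace

variable {E : Type*} [NormedAddCommGroup E] [InnerProductSpace ℝ E] {x y n : E}

theorem norm_sub_sq_of_norm_eq_one (hx : ‖x‖ = 1) (hy : ‖y‖ = 1) :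
    ‖x - y‖ ^ 2 = 2 * (1 - ⟪x, y⟫) := by
  rw [norm_sub_sq_real, hx, hy]
  ring

theorem hasFDerivAt_normalize (hy : ‖y‖ = 1) :
    HasFDerivAt (fun z : E => ‖z‖⁻¹ • z)
      (ContinuousLinearMap.id ℝ E - (innerSL ℝ y).smulRight y) y := by
  have norm_ne : ‖y‖ ^ 2 ≠ 0 := by simp [hy]
  have deriv_norm : HasFDerivAt (fun z : E => ‖z‖) (innerSL ℝ y) y := by
    have := (hasStrictFDerivAt_norm_sq y).hasFDerivAt.sqrt norm_ne
    simp only [Real.sqrt_sq (norm_nonneg _), hy] at this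
    refine this.congr_fderiv ?_
    ext v
    simp
  have deriv_inv : HasFDerivAt (fun z : E => ‖z‖⁻¹) (-innerSL ℝ y) y := by
    refine ((hasDerivAt_inv (by simp [hy])).comp_hasFDerivAt y deriv_norm).congr_fderiv ?_
    ext v
    simp [hy]
  refine (deriv_inv.smul (hasFDerivAt_id y)).congr_fderiv ?_
  ext v
  simp [hy, sub_eq_add_neg]

theorem hasDerivAt_normalize_add_smul (hy : ‖y‖ = 1) (hyn : ⟪y, n⟫ = 0) :
    HasDerivAt (fun δ : ℝ => ‖y + δ • n‖⁻¹ • (y + δ • n)) n 0 := by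
  have line : HasDerivAt (fun δ : ℝ => y + δ • n) n 0 := by
    simpa using ((hasDerivAt_id (0 : ℝ)).smul_const n).const_add y
  have normalize : HasFDerivAt (fun z : E => ‖z‖⁻¹ • z)
      (ContinuousLinearMap.id ℝ E - (innerSL ℝ y).smulRight y) (y + (0 : ℝ) • n) := by
    simpa using hasFDerivAt_normalize hy
  refine (HasFDerivAt.comp_hasDerivAt (0 : ℝ) normalize line).congr_deriv ?_
  simp [hyn]

end InnerProductSpace

/-! ### The kernel of the double layer potential -/

theorem hasFDerivAt_fundamentalSolution {x y : E3} (hxy : ⟪x, y⟫ ≠ 1) :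
    HasFDerivAt (fundamentalSolution x)
      ((1 / (4 * Real.pi) * (1 - ⟪x, y⟫)⁻¹) • innerSL ℝ x) y := by
  have inner_deriv : HasFDerivAt (fun z : E3 => ⟪x, z⟫) (innerSL ℝ x) y :=
    (innerSL ℝ x).hasFDerivAt
  have log_deriv := ((inner_deriv.const_sub 1).log (sub_ne_zero.2 hxy.symm)).const_mul
    (-(1 / (4 * Real.pi)))
  simp only [← Real.log_abs (1 - _)] at log_deriv
  refine log_deriv.congr_fderiv ?_
  ext v
  simp only [smul_apply, neg_apply, smul_eq_mul]
  ring

theorem surfaceGradient_fundamentalSolution {x y : E3} (hy : ‖y‖ = 1) (hxy : ⟪x, y⟫ ≠ 1) :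
    surfaceGradient (fundamentalSolution x) y =
      (1 / (4 * Real.pi) * (1 - ⟪x, y⟫)⁻¹) • (x - ⟪x, y⟫ • y) := by
  have outer : HasFDerivAt (fundamentalSolution x)
      ((1 / (4 * Real.pi) * (1 - ⟪x, y⟫)⁻¹) • innerSL ℝ x) (‖y‖⁻¹ • y) := by
    simpa [hy] using hasFDerivAt_fundamentalSolution hxy
  refine HasGradientAt.gradient (hasGradientAt_iff_hasFDerivAt.2
    ((HasFDerivAt.comp (f := fun z : E3 => ‖z‖⁻¹ • z) y outer
      (hasFDerivAt_normalize hy)).congr_fderiv ?_))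
  ext v
  simp [mul_comm]
  ring

theorem inner_surfaceCurl_fundamentalSolution {x y : E3} (hx : ‖x‖ = 1) (hy : ‖y‖ = 1)
    (hxy : x ≠ y) (t : E3) :
    ⟪surfaceCurl (fundamentalSolution x) y, t⟫ =
      1 / (2 * Real.pi) * (⟪cross x y, t⟫ / ‖x - y‖ ^ 2) := by
  have hne : ⟪x, y⟫ ≠ 1 := fun h => hxy ((inner_eq_one_iff_of_norm_eq_one hx hy).1 h)
  rw [surfaceCurl, surfaceGradient_fundamentalSolution hy hne, cross_smul_left, cross_sub_left,
    cross_smul_left, cross_self_eq_zero, smul_zero, sub_zero, real_inner_smul_left,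
    norm_sub_sq_of_norm_eq_one hx hy]
  have := sub_ne_zero.2 hne.symm
  field_simp
  ring

/-! ### Regular arcs of class `C²` -/

section Arc

variable {E : Type*} [NormedAddCommGroup E] [NormedSpace ℝ E] {γ : ℝ → E} {a b : ℝ}

theorem exists_norm_derivWithin_sub_le (hab : a < b) (hγ : ContDiffOn ℝ 2 γ (Icc a b)) :
    ∃ M, 0 ≤ M ∧ ∀ τ ∈ Icc a b, ∀ σ ∈ Icc a b,
      ‖derivWithin γ (Icc a b) σ - derivWithin γ (Icc a b) τ‖ ≤ M * |σ - τ| := by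
  have hderiv : ContDiffOn ℝ 1 (derivWithin γ (Icc a b)) (Icc a b) :=
    hγ.derivWithin (uniqueDiffOn_Icc hab) (by norm_num)
  obtain ⟨M, hM⟩ := isCompact_Icc.exists_bound_of_continuousOn
    (hderiv.continuousOn_derivWithin (uniqueDiffOn_Icc hab) le_rfl)
  exact ⟨M, (norm_nonneg _).trans (hM a (left_mem_Icc.2 hab.le)), fun τ hτ σ hσ =>
    (convex_Icc a b).norm_image_sub_le_of_norm_derivWithin_le
      (hderiv.differentiableOn one_ne_zero) hM hτ hσ⟩

theorem exists_norm_taylor_le (hab : a < b) (hγ : ContDiffOn ℝ 2 γ (Icc a b)) :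
    ∃ M, 0 ≤ M ∧ ∀ τ ∈ Icc a b, ∀ σ ∈ Icc a b,
      ‖γ σ - γ τ - (σ - τ) • derivWithin γ (Icc a b) τ‖ ≤ M * (σ - τ) ^ 2 := by
  obtain ⟨M, hM0, hM⟩ := exists_norm_derivWithin_sub_le hab hγ
  refine ⟨M, hM0, fun τ hτ σ hσ => ?_⟩
  have hsub : uIcc τ σ ⊆ Icc a b := (convex_Icc a b).ordConnected.uIcc_subset hτ hσ
  have hder (ρ) (hρ : ρ ∈ uIcc τ σ) :
      HasDerivWithinAt (fun ρ => γ ρ - (ρ - τ) • derivWithin γ (Icc a b) τ)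
        (derivWithin γ (Icc a b) ρ - derivWithin γ (Icc a b) τ) (uIcc τ σ) ρ := by
    have hlin : HasDerivWithinAt (fun ρ => (ρ - τ) • derivWithin γ (Icc a b) τ)
        (derivWithin γ (Icc a b) τ) (uIcc τ σ) ρ := by
      simpa using ((hasDerivWithinAt_id ρ (uIcc τ σ)).sub_const τ).smul_const
        (derivWithin γ (Icc a b) τ)
    exact ((hγ.differentiableOn two_ne_zero ρ (hsub hρ)).hasDerivWithinAt.mono hsub).sub hlin
  have hbound (ρ) (hρ : ρ ∈ uIcc τ σ) :
      ‖derivWithin γ (Icc a b) ρ - derivWithin γ (Icc a b) τ‖ ≤ M * |σ - τ| :=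
    (hM τ hτ ρ (hsub hρ)).trans
      (mul_le_mul_of_nonneg_left (abs_sub_left_of_mem_uIcc hρ) hM0)
  have key := (convex_uIcc τ σ).norm_image_sub_le_of_norm_hasDerivWithin_le hder hbound
    left_mem_uIcc right_mem_uIcc
  rw [Real.norm_eq_abs, mul_assoc, ← sq, sq_abs, sub_self, zero_smul, sub_zero,
    sub_right_comm] at key
  exact key

theorem exists_mul_abs_sub_le_norm_sub (hab : a < b) (hγ : ContDiffOn ℝ 2 γ (Icc a b))
    (hreg : ∀ τ ∈ Icc a b, derivWithin γ (Icc a b) τ ≠ 0) :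
    ∃ l > 0, ∀ᶠ η in 𝓝[>] (0 : ℝ), ∀ τ ∈ Icc a b, ∀ σ ∈ Icc a b,
      |σ - τ| ≤ η → l * |σ - τ| ≤ ‖γ σ - γ τ‖ := by
  obtain ⟨M, hM0, hM⟩ := exists_norm_taylor_le hab hγ
  obtain ⟨τ₀, hτ₀, hmin⟩ := isCompact_Icc.exists_isMinOn (nonempty_Icc.2 hab.le)
    (hγ.continuousOn_derivWithin (uniqueDiffOn_Icc hab) one_le_two).norm
  have hpos := norm_pos_iff.2 (hreg τ₀ hτ₀)
  simp only [isMinOn_iff] at hmin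
  generalize ‖derivWithin γ (Icc a b) τ₀‖ = m at hmin hpos
  have hsmall : ∀ᶠ η in 𝓝[>] (0 : ℝ), M * η < m / 2 :=
    ((continuous_const_mul M).tendsto' 0 0 (mul_zero M)).eventually_lt_const
      (half_pos hpos) |>.filter_mono nhdsWithin_le_nhds
  refine ⟨m / 2, half_pos hpos, hsmall.mono fun η hη τ hτ σ hσ hστ => ?_⟩
  have htaylor := hM τ hτ σ hσ
  have hm : m ≤ ‖derivWithin γ (Icc a b) τ‖ := hmin τ hτ
  have hchord := norm_sub_norm_le ((σ - τ) • derivWithin γ (Icc a b) τ)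
    ((σ - τ) • derivWithin γ (Icc a b) τ - (γ σ - γ τ))
  rw [sub_sub_cancel, norm_sub_rev _ (γ σ - γ τ), norm_smul, Real.norm_eq_abs] at hchord
  rw [← sq_abs] at htaylor
  nlinarith [abs_nonneg (σ - τ), mul_le_mul_of_nonneg_left hm (abs_nonneg (σ - τ)),
    mul_le_mul_of_nonneg_left hστ hM0]

end Arc

section InnerProductSpace

variable {E : Type*} [NormedAddCommGroup E] [InnerProductSpace ℝ E] {p q : E}

theorem inner_self_add_pos (hp : ‖p‖ = 1) (hq : ‖q‖ = 1) (hpq : p ≠ -q) : 0 < ⟪p, p + q⟫ := by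
  have hsum : 0 < ‖p + q‖ ^ 2 :=
    pow_pos (norm_pos_iff.2 fun h => hpq (eq_neg_of_add_eq_zero_left h)) 2
  rw [norm_add_sq_real, hp, hq] at hsum
  rw [inner_add_right, real_inner_self_eq_norm_sq, hp]
  linarith

end InnerProductSpace

/-! ### Regularity of the parametrization -/

namespace SphereCurve

variable (C : SphereCurve)

theorem norm_path (s : ℝ) : ‖C.path s‖ = 1 := by
  simp [path]

theorem periodic_path : Function.Periodic C.path C.N := fun s => by
  simp only [path, C.periodic s]

theorem periodic_deriv_path : Function.Periodic (deriv C.path) C.N := fun s => by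
  rw [← deriv_comp_add_const, funext C.periodic_path]

theorem N_pos_real : (0 : ℝ) < C.N := Nat.cast_pos.2 C.N_pos

theorem contDiffOn_path (k : ℤ) : ContDiffOn ℝ 2 C.path (Icc (k : ℝ) (k + 1)) := C.contDiffOn k

theorem continuousOn_derivWithin_arc (k : ℤ) :
    ContinuousOn (derivWithin C.path (Icc (k : ℝ) (k + 1))) (Icc (k : ℝ) (k + 1)) :=
  (C.contDiffOn_path k).continuousOn_derivWithin (uniqueDiffOn_Icc (lt_add_one _)) one_le_two

theorem hasDerivWithinAt_arc {k : ℤ} {τ : ℝ} (hτ : τ ∈ Icc (k : ℝ) (k + 1)) :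
    HasDerivWithinAt C.path (derivWithin C.path (Icc (k : ℝ) (k + 1)) τ) (Icc (k : ℝ) (k + 1)) τ :=
  ((C.contDiffOn_path k).differentiableOn two_ne_zero τ hτ).hasDerivWithinAt

theorem deriv_eq_derivWithin_arc {k : ℤ} {τ : ℝ} (hτ : τ ∈ Ioo (k : ℝ) (k + 1)) :
    deriv C.path τ = derivWithin C.path (Icc (k : ℝ) (k + 1)) τ :=
  (derivWithin_of_mem_nhds (Icc_mem_nhds hτ.1 hτ.2)).symm

/-- The one-sided derivative on the side of larger parameters. -/
def rightDeriv (s : ℝ) : E3 := derivWithin C.path (Ici s) s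

/-- The one-sided derivative on the side of smaller parameters, in the direction of increasing
parameter. -/
def leftDeriv (s : ℝ) : E3 := derivWithin C.path (Iic s) s

theorem exists_mem_Ico_arc (s : ℝ) : ∃ k : ℤ, s ∈ Ico (k : ℝ) (k + 1) :=
  ⟨⌊s⌋, Int.floor_le s, Int.lt_floor_add_one s⟩

theorem exists_mem_Ioc_arc (s : ℝ) : ∃ k : ℤ, s ∈ Ioc (k : ℝ) (k + 1) :=
  ⟨⌈s⌉ - 1, by push_cast; linarith [Int.ceil_lt_add_one s], by push_cast; linarith [Int.le_ceil s]⟩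

theorem hasDerivWithinAt_Ici_arc {k : ℤ} {s : ℝ} (hs : s ∈ Ico (k : ℝ) (k + 1)) :
    HasDerivWithinAt C.path (derivWithin C.path (Icc (k : ℝ) (k + 1)) s) (Ici s) s :=
  ((C.hasDerivWithinAt_arc (Ico_subset_Icc_self hs)).mono
    (Icc_subset_Icc_left hs.1)).mono_of_mem_nhdsWithin (Icc_mem_nhdsGE hs.2)

theorem hasDerivWithinAt_Iic_arc {k : ℤ} {s : ℝ} (hs : s ∈ Ioc (k : ℝ) (k + 1)) :
    HasDerivWithinAt C.path (derivWithin C.path (Icc (k : ℝ) (k + 1)) s) (Iic s) s :=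
  ((C.hasDerivWithinAt_arc (Ioc_subset_Icc_self hs)).mono
    (Icc_subset_Icc_right hs.2)).mono_of_mem_nhdsWithin (Icc_mem_nhdsLE hs.1)

theorem rightDeriv_eq {k : ℤ} {s : ℝ} (hs : s ∈ Ico (k : ℝ) (k + 1)) :
    C.rightDeriv s = derivWithin C.path (Icc (k : ℝ) (k + 1)) s :=
  (C.hasDerivWithinAt_Ici_arc hs).derivWithin (uniqueDiffOn_Ici s s self_mem_Ici)

theorem leftDeriv_eq {k : ℤ} {s : ℝ} (hs : s ∈ Ioc (k : ℝ) (k + 1)) :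
    C.leftDeriv s = derivWithin C.path (Icc (k : ℝ) (k + 1)) s :=
  (C.hasDerivWithinAt_Iic_arc hs).derivWithin (uniqueDiffOn_Iic s s self_mem_Iic)

theorem rightDeriv_ne_zero (s : ℝ) : C.rightDeriv s ≠ 0 := by
  obtain ⟨k, hk⟩ := exists_mem_Ico_arc s
  exact C.rightDeriv_eq hk ▸ C.regular k s (Ico_subset_Icc_self hk)

theorem leftDeriv_ne_zero (s : ℝ) : C.leftDeriv s ≠ 0 := by
  obtain ⟨k, hk⟩ := exists_mem_Ioc_arc s
  exact C.leftDeriv_eq hk ▸ C.regular k s (Ioc_subset_Icc_self hk)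

theorem hasDerivWithinAt_rightDeriv (s : ℝ) :
    HasDerivWithinAt C.path (C.rightDeriv s) (Ici s) s := by
  obtain ⟨k, hk⟩ := exists_mem_Ico_arc s
  exact C.rightDeriv_eq hk ▸ C.hasDerivWithinAt_Ici_arc hk

theorem hasDerivWithinAt_leftDeriv (s : ℝ) :
    HasDerivWithinAt C.path (C.leftDeriv s) (Iic s) s := by
  obtain ⟨k, hk⟩ := exists_mem_Ioc_arc s
  exact C.leftDeriv_eq hk ▸ C.hasDerivWithinAt_Iic_arc hk

theorem continuous_path : Continuous C.path :=
  continuous_iff_continuousAt.2 fun s => continuousAt_iff_continuous_left_right.2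
    ⟨(C.hasDerivWithinAt_leftDeriv s).continuousWithinAt,
      (C.hasDerivWithinAt_rightDeriv s).continuousWithinAt⟩

theorem continuous_pt : Continuous C.pt := continuous_induced_rng.2 C.continuous_path

theorem tendsto_deriv_right (s : ℝ) :
    Tendsto (deriv C.path) (𝓝[>] s) (𝓝 (C.rightDeriv s)) := by
  obtain ⟨k, hk⟩ := exists_mem_Ico_arc s
  have hsub : Ioo s (k + 1) ⊆ Ioo (k : ℝ) (k + 1) := Ioo_subset_Ioo_left hk.1
  rw [C.rightDeriv_eq hk, ← nhdsWithin_Ioo_eq_nhdsGT hk.2]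
  refine ((C.continuousOn_derivWithin_arc k s (Ico_subset_Icc_self hk)).mono_left
    (nhdsWithin_mono s (hsub.trans Ioo_subset_Icc_self))).congr' ?_
  filter_upwards [self_mem_nhdsWithin] with τ hτ
  exact (C.deriv_eq_derivWithin_arc (hsub hτ)).symm

theorem tendsto_deriv_left (s : ℝ) :
    Tendsto (deriv C.path) (𝓝[<] s) (𝓝 (C.leftDeriv s)) := by
  obtain ⟨k, hk⟩ := exists_mem_Ioc_arc s
  have hsub : Ioo (k : ℝ) s ⊆ Ioo (k : ℝ) (k + 1) := Ioo_subset_Ioo_right hk.2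
  rw [C.leftDeriv_eq hk, ← nhdsWithin_Ioo_eq_nhdsLT hk.1]
  refine ((C.continuousOn_derivWithin_arc k s (Ioc_subset_Icc_self hk)).mono_left
    (nhdsWithin_mono s (hsub.trans Ioo_subset_Icc_self))).congr' ?_
  filter_upwards [self_mem_nhdsWithin] with τ hτ
  exact (C.deriv_eq_derivWithin_arc (hsub hτ)).symm

theorem eventually_contDiffAt (s : ℝ) : ∀ᶠ τ in 𝓝[≠] s, ContDiffAt ℝ 2 C.path τ := by
  have harc (k : ℤ) (τ : ℝ) (hτ : τ ∈ Ioo (k : ℝ) (k + 1)) : ContDiffAt ℝ 2 C.path τ :=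
    (C.contDiffOn_path k).contDiffAt (Icc_mem_nhds hτ.1 hτ.2)
  rw [← nhdsLT_sup_nhdsGT, eventually_sup]
  constructor
  · obtain ⟨k, hk⟩ := exists_mem_Ioc_arc s
    filter_upwards [Ioo_mem_nhdsLT hk.1] with τ hτ
    exact harc k τ ⟨hτ.1, hτ.2.trans_le hk.2⟩
  · obtain ⟨k, hk⟩ := exists_mem_Ico_arc s
    filter_upwards [Ioo_mem_nhdsGT hk.2] with τ hτ
    exact harc k τ ⟨hk.1.trans_lt hτ.1, hτ.2⟩

theorem exists_norm_deriv_le : ∃ M, ∀ s, ‖deriv C.path s‖ ≤ M := by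
  choose M hM using fun k : ℤ =>
    isCompact_Icc.exists_bound_of_continuousOn (C.continuousOn_derivWithin_arc k)
  obtain ⟨B, hB⟩ := ((Finset.Ico (0 : ℤ) C.N).image M).exists_le
  refine ⟨max 0 B, fun s => ?_⟩
  obtain ⟨σ, ⟨hσ0, hσN⟩, hσs⟩ := C.periodic_deriv_path.exists_mem_Ico₀ C.N_pos_real s
  rw [hσs]
  by_cases hd : DifferentiableAt ℝ C.path σ
  · obtain ⟨k, hk⟩ := exists_mem_Ico_arc σ
    have hk' := Ico_subset_Icc_self hk
    have h0 : (-1 : ℝ) < k := by linarith [hk.2]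
    have hN : (k : ℝ) < C.N := hk.1.trans_lt hσN
    have hmem : k ∈ Finset.Ico (0 : ℤ) C.N :=
      Finset.mem_Ico.2 ⟨by exact_mod_cast h0, by exact_mod_cast hN⟩
    rw [← hd.derivWithin (uniqueDiffOn_Icc (lt_add_one _) σ hk')]
    exact ((hM k σ hk').trans (hB _ (Finset.mem_image_of_mem M hmem))).trans (le_max_right _ _)
  · rw [deriv_zero_of_not_differentiableAt hd, norm_zero]
    exact le_max_left _ _

theorem inner_path_deriv (s : ℝ) : ⟪C.path s, deriv C.path s⟫ = 0 := by
  by_cases hd : DifferentiableAt ℝ C.path s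
  · have hsq := hd.hasDerivAt.norm_sq
    simp only [C.norm_path] at hsq
    linarith [hsq.unique (hasDerivAt_const s (1 ^ 2 : ℝ))]
  · rw [deriv_zero_of_not_differentiableAt hd, inner_zero_right]

theorem inner_path_eq_zero_of_tendsto {s : ℝ} {v : E3} {l : Filter ℝ} [l.NeBot] (hl : l ≤ 𝓝 s)
    (hv : Tendsto (deriv C.path) l (𝓝 v)) : ⟪C.path s, v⟫ = 0 := by
  have hlim := (C.continuous_path.continuousAt.tendsto.mono_left hl).inner (𝕜 := ℝ) hv
  simp only [C.inner_path_deriv] at hlim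
  exact tendsto_nhds_unique hlim tendsto_const_nhds

theorem inner_path_rightDeriv (s : ℝ) : ⟪C.path s, C.rightDeriv s⟫ = 0 :=
  C.inner_path_eq_zero_of_tendsto nhdsWithin_le_nhds (C.tendsto_deriv_right s)

theorem inner_path_leftDeriv (s : ℝ) : ⟪C.path s, C.leftDeriv s⟫ = 0 :=
  C.inner_path_eq_zero_of_tendsto nhdsWithin_le_nhds (C.tendsto_deriv_left s)

theorem rightTangent_eq (s : ℝ) :
    rightTangent C.path s = ‖C.rightDeriv s‖⁻¹ • C.rightDeriv s := rfl

theorem leftTangent_eq (s : ℝ) :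
    leftTangent C.path s = ‖C.leftDeriv s‖⁻¹ • C.leftDeriv s := rfl

theorem norm_rightTangent (s : ℝ) : ‖rightTangent C.path s‖ = 1 := by
  simpa [rightTangent_eq] using norm_smul_inv_norm (𝕜 := ℝ) (C.rightDeriv_ne_zero s)

theorem norm_leftTangent (s : ℝ) : ‖leftTangent C.path s‖ = 1 := by
  simpa [leftTangent_eq] using norm_smul_inv_norm (𝕜 := ℝ) (C.leftDeriv_ne_zero s)

theorem norm_deriv_smul_tangent (s : ℝ) : ‖deriv C.path s‖ • C.tangent s = deriv C.path s := by
  by_cases hd : DifferentiableAt ℝ C.path s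
  · have : C.rightDeriv s = deriv C.path s := hd.derivWithin (uniqueDiffOn_Ici s s self_mem_Ici)
    rw [tangent, rightTangent_eq, this, smul_inv_smul₀]
    rw [← this]
    exact norm_ne_zero_iff.2 (C.rightDeriv_ne_zero s)
  · rw [deriv_zero_of_not_differentiableAt hd, norm_zero, zero_smul]

/-- A unit vector `a`, tangent to the sphere at `C.pt s`, such that both one-sided derivatives of
the path at `s` have a positive component along `a`. -/
structure IsTransversal (s : ℝ) (a : E3) : Prop extends IsFrame a (C.path s) where
  inner_rightDeriv_pos : 0 < ⟪a, C.rightDeriv s⟫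
  inner_leftDeriv_pos : 0 < ⟪a, C.leftDeriv s⟫

/-- The absence of cusps makes the bisector of the one-sided tangents transversal. -/
theorem exists_isTransversal (s : ℝ) : ∃ a, C.IsTransversal s a := by
  have hright := inner_self_add_pos (C.norm_rightTangent s) (C.norm_leftTangent s) (C.no_cusp s)
  have hleft := inner_self_add_pos (C.norm_leftTangent s) (C.norm_rightTangent s)
    fun h => C.no_cusp s (neg_eq_iff_eq_neg.2 h).symm
  have htangent : ⟪C.path s, rightTangent C.path s + leftTangent C.path s⟫ = 0 := by
    rw [inner_add_right, rightTangent_eq, leftTangent_eq, inner_smul_right, inner_smul_right,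
      C.inner_path_rightDeriv, C.inner_path_leftDeriv, mul_zero, mul_zero, add_zero]
  have hne : rightTangent C.path s + leftTangent C.path s ≠ 0 := fun h => by
    rw [h, inner_zero_right] at hright
    exact hright.false
  rw [add_comm] at hleft
  generalize rightTangent C.path s + leftTangent C.path s = w at *
  rw [rightTangent_eq, real_inner_smul_left, real_inner_comm] at hright
  rw [leftTangent_eq, real_inner_smul_left, real_inner_comm] at hleft
  refine ⟨‖w‖⁻¹ • w, ⟨by simpa using norm_smul_inv_norm (𝕜 := ℝ) hne, C.norm_path s, ?_⟩, ?_, ?_⟩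
  · rw [real_inner_smul_right, htangent, mul_zero]
  · rw [real_inner_smul_left]
    exact mul_pos (by positivity) (pos_of_mul_pos_right hright (by positivity))
  · rw [real_inner_smul_left]
    exact mul_pos (by positivity) (pos_of_mul_pos_right hleft (by positivity))

end SphereCurve

/-! ### Uniform integrability of the kernel -/

theorem intervalIntegrable_poisson {d l : ℝ} (hl : 0 < l) (hd : 0 ≤ d) (σ A B : ℝ) :
    IntervalIntegrable (fun τ => d / (d ^ 2 + l ^ 2 * (τ - σ) ^ 2)) volume A B := by
  rcases hd.eq_or_lt with rfl | hd
  · simp only [zero_div, intervalIntegrable_const]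
  · exact (continuous_const.div (by fun_prop) fun τ => by positivity).intervalIntegrable A B

theorem integral_poisson_le {d l : ℝ} (hl : 0 < l) (hd : 0 ≤ d) (σ A B : ℝ) :
    ∫ τ in A..B, d / (d ^ 2 + l ^ 2 * (τ - σ) ^ 2) ≤ Real.pi / l := by
  have hint := intervalIntegrable_poisson hl hd σ A B
  rcases hd.eq_or_lt with rfl | hd
  · simp only [zero_div, intervalIntegral.integral_zero]
    positivity
  have hder (τ : ℝ) : HasDerivAt (fun τ => Real.arctan (l * (τ - σ) / d) / l)
      (d / (d ^ 2 + l ^ 2 * (τ - σ) ^ 2)) τ := by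
    have hlin : HasDerivAt (fun τ => l * (τ - σ) / d) (l * 1 / d) τ :=
      (((hasDerivAt_id τ).sub_const σ).const_mul l).div_const d
    refine (hlin.arctan.div_const l).congr_deriv ?_
    have : d ^ 2 + l ^ 2 * (τ - σ) ^ 2 ≠ 0 := by positivity
    field_simp
  rw [intervalIntegral.integral_eq_sub_of_hasDerivAt (fun τ _ => hder τ) hint, ← sub_div]
  gcongr
  linarith [Real.arctan_lt_pi_div_two (l * (B - σ) / d),
    Real.neg_pi_div_two_lt_arctan (l * (A - σ) / d)]

theorem add_mul_sq_div_sq_le {d l M u R : ℝ} (hd : 0 ≤ d) (hl : 0 < l) (hM : 0 ≤ M)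
    (hdR : d ≤ R) (hlR : l * |u| ≤ R) :
    (d + M * u ^ 2) / R ^ 2 ≤ 2 * (d / (d ^ 2 + l ^ 2 * u ^ 2)) + M / l ^ 2 := by
  have hd2 : d ^ 2 ≤ R ^ 2 := pow_le_pow_left₀ hd hdR 2
  have hl2 : l ^ 2 * u ^ 2 ≤ R ^ 2 := by
    simpa only [mul_pow, sq_abs] using pow_le_pow_left₀ (by positivity) hlR 2
  rw [add_div]
  refine add_le_add ?_ ?_
  · rcases hd.eq_or_lt with rfl | hd
    · simp
    · have hR : 0 < R := hd.trans_le hdR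
      rw [mul_div_assoc', div_le_div_iff₀ (by positivity) (by positivity)]
      nlinarith
  · rcases (sq_nonneg R).eq_or_lt with hR | hR
    · rw [← hR, div_zero]
      positivity
    · rw [div_le_div_iff₀ hR (by positivity)]
      nlinarith

theorem abs_inner_cross_le_add (x p y v : E3) (t : ℝ) :
    |⟪cross x y, v⟫| ≤ (‖x - p‖ + ‖p - y - t • v‖) * (‖y‖ * ‖v‖) := by
  have hsplit : ⟪cross x y, v⟫ = ⟪cross (x - p) y, v⟫ + ⟪cross (p - y - t • v) y, v⟫ := by
    simp only [cross_sub_left, cross_smul_left, cross_self_eq_zero, inner_sub_left,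
      real_inner_smul_left, inner_cross_left_self, inner_zero_left]
    ring
  rw [hsplit, add_mul, ← mul_assoc, ← mul_assoc]
  exact (abs_add_le _ _).trans (add_le_add (abs_inner_cross_le _ _ _) (abs_inner_cross_le _ _ _))

namespace SphereCurve

variable (C : SphereCurve)

/-- The kernel of the double layer potential with respect to the parameter, that is, the integrand
for the density `1` times the arc length factor. It is `0` where `C.path s = x`. -/
def kernel (x : E3) (s : ℝ) : ℝ :=
  1 / (2 * Real.pi) * (⟪cross x (C.path s), deriv C.path s⟫ / ‖x - C.path s‖ ^ 2)

theorem doubleLayerIntegrand_mul (μ : Sphere2 → ℝ) (x : Sphere2) {s : ℝ} (hs : C.pt s ≠ x) :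
    C.doubleLayerIntegrand C.tangent μ x s * ‖deriv C.path s‖ = μ (C.pt s) * C.kernel x s := by
  have hne : (x : E3) ≠ C.path s := fun h => hs (Subtype.ext h.symm)
  rw [doubleLayerIntegrand, mul_assoc, mul_comm ⟪_, _⟫, ← real_inner_smul_right,
    C.norm_deriv_smul_tangent,
    inner_surfaceCurl_fundamentalSolution (norm_eq_of_mem_sphere x) (C.norm_path s) hne, kernel]

theorem periodic_kernel (x : E3) : Function.Periodic (C.kernel x) C.N := fun s => by
  simp only [kernel, C.periodic_path s, C.periodic_deriv_path s]

theorem measurable_kernel (x : E3) : Measurable (C.kernel x) := by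
  have hcross : Continuous fun s => cross x (C.path s) :=
    continuous_cross.comp (continuous_const.prodMk C.continuous_path)
  have hnorm : Continuous fun s => ‖x - C.path s‖ ^ 2 :=
    (continuous_const.sub C.continuous_path).norm.pow 2
  exact ((hcross.measurable.inner (measurable_deriv C.path)).div hnorm.measurable).const_mul _

theorem abs_kernel_le (x : E3) (s : ℝ) :
    |C.kernel x s| ≤ |⟪cross x (C.path s), deriv C.path s⟫| / ‖x - C.path s‖ ^ 2 := by
  have hpi : |1 / (2 * Real.pi)| ≤ 1 := by
    rw [abs_of_pos (by positivity), div_le_one (by positivity)]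
    linarith [Real.pi_gt_three]
  rw [kernel, abs_mul, abs_div (⟪_, _⟫ : ℝ), abs_of_nonneg (sq_nonneg ‖x - C.path s‖)]
  exact mul_le_of_le_one_left (by positivity) hpi

theorem abs_kernel_le_of_taylor {x : E3} {l M M' σ τ : ℝ} (hl : 0 < l) (hM : 0 ≤ M)
    (hderiv : ‖deriv C.path τ‖ ≤ M')
    (htaylor : ‖C.path σ - C.path τ - (σ - τ) • deriv C.path τ‖ ≤ M * (σ - τ) ^ 2)
    (hnearest : ‖x - C.path σ‖ ≤ ‖x - C.path τ‖) (hchord : l * |σ - τ| ≤ ‖x - C.path τ‖) :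
    |C.kernel x τ| ≤ M' * (2 * (‖x - C.path σ‖ /
      (‖x - C.path σ‖ ^ 2 + l ^ 2 * (τ - σ) ^ 2)) + M / l ^ 2) := by
  have hM' : 0 ≤ M' := (norm_nonneg _).trans hderiv
  have hnum := abs_inner_cross_le_add x (C.path σ) (C.path τ) (deriv C.path τ) (σ - τ)
  rw [C.norm_path, one_mul] at hnum
  calc |C.kernel x τ|
      ≤ |⟪cross x (C.path τ), deriv C.path τ⟫| / ‖x - C.path τ‖ ^ 2 := C.abs_kernel_le x τ
    _ ≤ (‖x - C.path σ‖ + M * (σ - τ) ^ 2) * M' / ‖x - C.path τ‖ ^ 2 := by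
        gcongr
        exact hnum.trans (by gcongr)
    _ = M' * ((‖x - C.path σ‖ + M * (σ - τ) ^ 2) / ‖x - C.path τ‖ ^ 2) := by ring
    _ ≤ _ := by
        rw [← neg_sub τ σ, abs_neg] at hchord
        rw [← neg_sub τ σ, neg_sq]
        gcongr
        exact add_mul_sq_div_sq_le (norm_nonneg _) hl hM hnearest hchord

/-- If `σ` is the parameter of the point of a short arc next to `x` and `d` is the distance, then
`C.path τ` has distance comparable to `d + |τ - σ|` from `x`, uniformly in `x`. -/
theorem exists_abs_kernel_arc_le (k : ℤ) : ∃ l > 0, ∃ M ≥ 0, ∃ M' ≥ 0, ∀ᶠ η in 𝓝[>] (0 : ℝ),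
    ∀ x A B, A ≤ B → Icc A B ⊆ Icc (k : ℝ) (k + 1) → B - A ≤ η → ∃ d ≥ 0, ∃ σ, ∀ τ ∈ Ioo A B,
      |C.kernel x τ| ≤ M' * (2 * (d / (d ^ 2 + l ^ 2 * (τ - σ) ^ 2)) + M / l ^ 2) := by
  obtain ⟨l, hl, hchord⟩ :=
    exists_mul_abs_sub_le_norm_sub (lt_add_one _) (C.contDiffOn_path k) (C.regular k)
  obtain ⟨M, hM0, hM⟩ := exists_norm_taylor_le (lt_add_one _) (C.contDiffOn_path k)
  obtain ⟨M', hM'⟩ := C.exists_norm_deriv_le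
  refine ⟨l / 2, half_pos hl, M, hM0, M', (norm_nonneg _).trans (hM' 0),
    hchord.mono fun η hη x A B hAB hsub hBA => ?_⟩
  obtain ⟨σ, hσ, hmin⟩ := isCompact_Icc.exists_isMinOn (nonempty_Icc.2 hAB)
    (continuous_const.sub C.continuous_path).norm.continuousOn
  refine ⟨‖x - C.path σ‖, norm_nonneg _, σ, fun τ hτ => ?_⟩
  have hτ' := Ioo_subset_Icc_self hτ
  have hnearest : ‖x - C.path σ‖ ≤ ‖x - C.path τ‖ := hmin hτ'
  have harc := (Icc_subset_Icc_iff hAB).1 hsub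
  have hτk : τ ∈ Ioo (k : ℝ) (k + 1) := ⟨harc.1.trans_lt hτ.1, hτ.2.trans_le harc.2⟩
  refine C.abs_kernel_le_of_taylor (half_pos hl) hM0 (hM' τ) ?_ hnearest ?_
  · rw [C.deriv_eq_derivWithin_arc hτk]
    exact hM τ (hsub hτ') σ (hsub hσ)
  · have hlip := hη τ (hsub hτ') σ (hsub hσ) ((Real.dist_le_of_mem_Icc hσ hτ').trans hBA)
    have htri := norm_sub_le_norm_sub_add_norm_sub (C.path σ) x (C.path τ)
    rw [norm_sub_rev _ x] at htri
    linarith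

theorem exists_integral_abs_kernel_arc_le (k : ℤ) : ∃ M, ∀ᶠ η in 𝓝[>] (0 : ℝ), ∀ x A B,
    A ≤ B → Icc A B ⊆ Icc (k : ℝ) (k + 1) → B - A ≤ η →
      IntervalIntegrable (C.kernel x) volume A B ∧ ∫ τ in A..B, |C.kernel x τ| ≤ M := by
  obtain ⟨l, hl, M, hM, M', hM', hbound⟩ := C.exists_abs_kernel_arc_le k
  refine ⟨M' * (2 * (Real.pi / l) + M / l ^ 2), ?_⟩
  filter_upwards [hbound, Ioc_mem_nhdsGT one_pos] with η hη hη1 x A B hAB hsub hBA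
  obtain ⟨d, hd, σ, hle⟩ := hη x A B hAB hsub hBA
  have hpoisson := intervalIntegrable_poisson hl hd σ A B
  have hg := ((hpoisson.const_mul 2).add (intervalIntegrable_const (c := M / l ^ 2))).const_mul M'
  have hint : IntervalIntegrable (C.kernel x) volume A B := by
    rw [intervalIntegrable_iff_integrableOn_Ioo_of_le hAB] at hg ⊢
    exact hg.mono' (C.measurable_kernel x).aestronglyMeasurable
      (ae_restrict_of_forall_mem measurableSet_Ioo hle)
  refine ⟨hint, (intervalIntegral.integral_mono_on_of_le_Ioo hAB hint.abs hg hle).trans ?_⟩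
  rw [intervalIntegral.integral_const_mul, intervalIntegral.integral_add
    (hpoisson.const_mul 2) intervalIntegrable_const, intervalIntegral.integral_const_mul,
    intervalIntegral.integral_const, smul_eq_mul]
  gcongr
  · exact integral_poisson_le hl hd σ A B
  · exact mul_le_of_le_one_left (by positivity) (hBA.trans hη1.2)

theorem exists_integral_abs_kernel_le (s : ℝ) : ∃ M, ∀ᶠ η in 𝓝[>] (0 : ℝ), ∀ x,
    IntervalIntegrable (C.kernel x) volume (s - η) (s + η) ∧
      ∫ τ in (s - η)..(s + η), |C.kernel x τ| ≤ M := by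
  obtain ⟨j, hj⟩ := exists_mem_Ioc_arc s
  obtain ⟨k, hk⟩ := exists_mem_Ico_arc s
  obtain ⟨M₁, hM₁⟩ := C.exists_integral_abs_kernel_arc_le j
  obtain ⟨M₂, hM₂⟩ := C.exists_integral_abs_kernel_arc_le k
  refine ⟨M₁ + M₂, ?_⟩
  filter_upwards [hM₁, hM₂, Ioc_mem_nhdsGT (sub_pos.2 hj.1), Ioc_mem_nhdsGT (sub_pos.2 hk.2)]
    with η h₁ h₂ hηj hηk x
  obtain ⟨hleft, hleft_le⟩ := h₁ x (s - η) s (by linarith [hηj.1])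
    (Icc_subset_Icc (by linarith [hηj.2]) hj.2) (by linarith)
  obtain ⟨hright, hright_le⟩ := h₂ x s (s + η) (by linarith [hηk.1])
    (Icc_subset_Icc hk.1 (by linarith [hηk.2])) (by linarith)
  refine ⟨hleft.trans hright, ?_⟩
  rw [← intervalIntegral.integral_add_adjacent_intervals hleft.abs hright.abs]
  exact add_le_add hleft_le hright_le

theorem intervalIntegrable_kernel (x : E3) (A B : ℝ) :
    IntervalIntegrable (C.kernel x) volume A B := by
  have hloc : LocallyIntegrable (C.kernel x) := fun s => by
    obtain ⟨M, hM⟩ := C.exists_integral_abs_kernel_le s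
    obtain ⟨η, hη, hη0⟩ := (hM.and self_mem_nhdsWithin).exists
    refine ⟨Ioc (s - η) (s + η), Ioc_mem_nhds (sub_lt_self s hη0) (lt_add_of_pos_right s hη0), ?_⟩
    exact (intervalIntegrable_iff_integrableOn_Ioc_of_le
      (by linarith)).1 (hη x).1
  exact (hloc.integrableOn_isCompact isCompact_uIcc).intervalIntegrable

end SphereCurve

/-! ### The principal value and the reduction to a local jump -/

namespace SphereCurve

variable {C : SphereCurve} {s : ℝ}

theorem exists_eq_add_int_mul_of_path_eq {τ : ℝ} (h : C.path τ = C.path s) :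
    ∃ n : ℤ, τ = s + n * C.N := by
  have hpt (σ : ℝ) : C.pt (toIcoMod C.N_pos_real 0 σ) = C.pt σ :=
    C.periodic.sub_zsmul_eq (toIcoDiv C.N_pos_real 0 σ)
  have hmem (σ : ℝ) : toIcoMod C.N_pos_real 0 σ ∈ Ico 0 (C.N : ℝ) := by
    simpa using toIcoMod_mem_Ico C.N_pos_real 0 σ
  have hmod := C.injOn (hmem s) (hmem τ) (by rw [hpt, hpt, ← Subtype.ext_iff.2 h.symm])
  obtain ⟨n, hn⟩ := (toIcoMod_eq_toIcoMod C.N_pos_real).1 hmod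
  exact ⟨n, by rw [zsmul_eq_mul] at hn; linarith⟩

theorem path_ne_of_mem_Ioo {τ : ℝ} (hτ : τ ∈ Ioo s (s + C.N)) : C.path τ ≠ C.path s := by
  intro h
  obtain ⟨n, rfl⟩ := exists_eq_add_int_mul_of_path_eq h
  have hpos : (0 : ℝ) < n := pos_of_mul_pos_left (by linarith [hτ.1]) C.N_pos_real.le
  have hlt : (n : ℝ) < 1 := by
    refine lt_of_mul_lt_mul_right (a := (C.N : ℝ)) ?_ C.N_pos_real.le
    linarith [hτ.2]
  norm_cast at hpos hlt
  omega

theorem ae_path_ne (s : ℝ) : ∀ᵐ τ, C.path τ ≠ C.path s := by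
  have hnull := (countable_range fun n : ℤ => s + n * (C.N : ℝ)).measure_zero volume
  refine measure_mono_null (fun τ hτ => ?_) hnull
  obtain ⟨n, hn⟩ := exists_eq_add_int_mul_of_path_eq (not_not.1 hτ)
  exact ⟨n, hn.symm⟩

theorem abs_kernel_le_div (x : E3) (τ : ℝ) :
    |C.kernel x τ| ≤ ‖deriv C.path τ‖ / ‖x - C.path τ‖ := by
  have hnum := abs_inner_cross_le_add x (C.path τ) (C.path τ) (deriv C.path τ) 0
  rw [C.norm_path, one_mul, sub_self, zero_smul, sub_zero, norm_zero, add_zero] at hnum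
  refine (C.abs_kernel_le x τ).trans ?_
  rcases (norm_nonneg (x - C.path τ)).eq_or_lt with h | h
  · simp [← h]
  · rw [div_le_div_iff₀ (by positivity) h]
    nlinarith [norm_nonneg (deriv C.path τ)]

theorem exists_eventually_abs_kernel_le {A B : ℝ} {x₀ : E3} (hne : ∀ τ ∈ uIcc A B, C.path τ ≠ x₀) :
    ∃ M, ∀ᶠ x in 𝓝 x₀, ∀ τ ∈ uIcc A B, |C.kernel x τ| ≤ M := by
  obtain ⟨M, hM⟩ := C.exists_norm_deriv_le
  obtain ⟨σ, hσ, hmin⟩ := isCompact_uIcc.exists_isMinOn nonempty_uIcc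
    (continuous_const.sub C.continuous_path).norm.continuousOn
  have hpos : 0 < ‖x₀ - C.path σ‖ := norm_pos_iff.2 (sub_ne_zero.2 (hne σ hσ).symm)
  refine ⟨M / (‖x₀ - C.path σ‖ / 2), ?_⟩
  filter_upwards [Metric.ball_mem_nhds x₀ (half_pos hpos)] with x hx τ hτ
  have hdist : ‖x₀ - C.path σ‖ / 2 ≤ ‖x - C.path τ‖ := by
    have hτ' : ‖x₀ - C.path σ‖ ≤ ‖x₀ - C.path τ‖ := hmin hτ
    have htri := norm_sub_le_norm_sub_add_norm_sub x₀ x (C.path τ)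
    rw [mem_ball_iff_norm'] at hx
    linarith
  refine (abs_kernel_le_div x τ).trans ?_
  gcongr
  · exact (norm_nonneg _).trans (hM τ)
  · exact hM τ

theorem continuousAt_kernel {x : E3} {τ : ℝ} (hne : C.path τ ≠ x) :
    ContinuousAt (fun z => C.kernel z τ) x := by
  have hcross : Continuous fun z : E3 => ⟪cross z (C.path τ), deriv C.path τ⟫ :=
    (continuous_cross.comp (continuous_id.prodMk continuous_const)).inner continuous_const
  have hnorm : Continuous fun z : E3 => ‖z - C.path τ‖ ^ 2 :=
    (continuous_id.sub continuous_const).norm.pow 2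
  exact continuousAt_const.mul (hcross.continuousAt.div hnorm.continuousAt
    (pow_ne_zero 2 (norm_ne_zero_iff.2 (sub_ne_zero.2 hne.symm))))

theorem tendsto_integral_kernel_of_ne {m : ℝ → ℝ} (hm : Continuous m) {A B : ℝ} {x₀ : E3}
    (hne : ∀ τ ∈ uIcc A B, C.path τ ≠ x₀) :
    Tendsto (fun x => ∫ τ in A..B, m τ * C.kernel x τ) (𝓝 x₀)
      (𝓝 (∫ τ in A..B, m τ * C.kernel x₀ τ)) := by
  obtain ⟨M, hM⟩ := exists_eventually_abs_kernel_le hne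
  refine intervalIntegral.tendsto_integral_filter_of_dominated_convergence
    (fun τ => |m τ| * M) ?_ ?_ ((hm.abs.mul continuous_const).intervalIntegrable A B) ?_
  · exact Eventually.of_forall fun x =>
      (hm.measurable.mul (C.measurable_kernel x)).aestronglyMeasurable
  · refine hM.mono fun x hx => ae_of_all _ fun τ hτ => ?_
    rw [Real.norm_eq_abs, abs_mul]
    exact mul_le_mul_of_nonneg_left (hx τ (uIoc_subset_uIcc hτ)) (abs_nonneg _)
  · exact ae_of_all _ fun τ hτ =>
      (continuousAt_kernel (hne τ (uIoc_subset_uIcc hτ))).tendsto.const_mul (m τ)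

theorem tendsto_integral_kernel_far {m : ℝ → ℝ} (hm : Continuous m) {η : ℝ}
    (hη : η ∈ Ioo 0 (C.N : ℝ)) :
    Tendsto (fun x => ∫ τ in (s + η)..(s - η + C.N), m τ * C.kernel x τ) (𝓝 (C.path s))
      (𝓝 (∫ τ in (s + η)..(s - η + C.N), m τ * C.kernel (C.path s) τ)) := by
  refine tendsto_integral_kernel_of_ne hm fun τ hτ => path_ne_of_mem_Ioo ?_
  refine ordConnected_Ioo.uIcc_subset ?_ ?_ hτ <;> constructor <;> linarith [hη.1, hη.2]

theorem intervalIntegrable_mul_kernel {m : ℝ → ℝ} (hm : Continuous m) (x : E3) (A B : ℝ) :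
    IntervalIntegrable (fun τ => m τ * C.kernel x τ) volume A B :=
  (C.intervalIntegrable_kernel x A B).continuousOn_mul hm.continuousOn

theorem integral_kernel_near_add_far {m : ℝ → ℝ} (hm : Continuous m)
    (hper : Function.Periodic m C.N) (x : E3) (s η : ℝ) :
    (∫ τ in (s - η)..(s + η), m τ * C.kernel x τ) +
        ∫ τ in (s + η)..(s - η + C.N), m τ * C.kernel x τ =
      ∫ τ in (0 : ℝ)..C.N, m τ * C.kernel x τ := by
  have hmul : Function.Periodic (fun τ => m τ * C.kernel x τ) C.N :=
    hper.mul (C.periodic_kernel x)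
  rw [intervalIntegral.integral_add_adjacent_intervals (intervalIntegrable_mul_kernel hm x _ _)
    (intervalIntegrable_mul_kernel hm x _ _),
    hmul.intervalIntegral_add_eq (s - η) 0, zero_add]

theorem abs_integral_mul_kernel_le {m : ℝ → ℝ} {e A B : ℝ} (hAB : A ≤ B)
    (hm : ∀ τ ∈ Icc A B, |m τ| ≤ e) (x : E3) :
    |∫ τ in A..B, m τ * C.kernel x τ| ≤ e * ∫ τ in A..B, |C.kernel x τ| := by
  rw [← intervalIntegral.integral_const_mul, ← Real.norm_eq_abs]
  refine intervalIntegral.norm_integral_le_of_norm_le hAB (ae_of_all _ fun τ hτ => ?_)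
    ((C.intervalIntegrable_kernel x A B).abs.const_mul e)
  rw [Real.norm_eq_abs, abs_mul]
  exact mul_le_mul_of_nonneg_right (hm τ (Ioc_subset_Icc_self hτ)) (abs_nonneg _)

theorem tendsto_integral_mul_kernel_of_eq_zero {m : ℝ → ℝ} (hm : Continuous m)
    (hper : Function.Periodic m C.N) (hms : m s = 0) :
    Tendsto (fun x => ∫ τ in (0 : ℝ)..C.N, m τ * C.kernel x τ) (𝓝 (C.path s))
      (𝓝 (∫ τ in (0 : ℝ)..C.N, m τ * C.kernel (C.path s) τ)) := by
  rw [Metric.tendsto_nhds]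
  intro ε hε
  obtain ⟨M, hM⟩ := C.exists_integral_abs_kernel_le s
  have hsmallM : ∀ᶠ e in 𝓝[>] (0 : ℝ), e * M < ε / 3 :=
    (((continuous_mul_const M).tendsto' 0 0 (zero_mul M)).eventually_lt_const
      (by positivity)).filter_mono nhdsWithin_le_nhds
  obtain ⟨e, heM, he : 0 < e⟩ := (hsmallM.and self_mem_nhdsWithin).exists
  have hsmall : ∀ᶠ η in 𝓝[>] (0 : ℝ), ∀ τ ∈ Icc (s - η) (s + η), |m τ| ≤ e := by
    obtain ⟨δ, hδ, hmδ⟩ := Metric.continuousAt_iff.1 (hm.continuousAt (x := s)) e he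
    filter_upwards [Ioo_mem_nhdsGT hδ] with η hη τ hτ
    have := hmδ (x := τ) (abs_lt.2 ⟨by linarith [hτ.1, hη.2], by linarith [hτ.2, hη.2]⟩)
    rw [hms, dist_zero_right] at this
    exact this.le
  obtain ⟨η, ⟨hηM, hηm⟩, hη⟩ := ((hM.and hsmall).and (Ioo_mem_nhdsGT C.N_pos_real)).exists
  have hnear (x : E3) : |∫ τ in (s - η)..(s + η), m τ * C.kernel x τ| < ε / 3 :=
    ((abs_integral_mul_kernel_le (by linarith [hη.1]) hηm x).trans
      (mul_le_mul_of_nonneg_left (hηM x).2 he.le)).trans_lt heM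
  filter_upwards [Metric.tendsto_nhds.1 (tendsto_integral_kernel_far hm hη) (ε / 3)
    (by positivity)] with x hx
  rw [Real.dist_eq] at hx ⊢
  rw [← integral_kernel_near_add_far hm hper x s η,
    ← integral_kernel_near_add_far hm hper (C.path s) s η, add_sub_add_comm]
  have h₁ := hnear x
  have h₂ := hnear (C.path s)
  rw [abs_lt] at *
  constructor <;> linarith [h₁.1, h₁.2, h₂.1, h₂.2, hx.1, hx.2]

theorem tendsto_integral_kernel {D : Set Sphere2} {J : ℝ}
    (hJ : ∀ᶠ η in 𝓝[>] (0 : ℝ), Tendsto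
      (fun x : Sphere2 => ∫ τ in (s - η)..(s + η), (C.kernel x τ - C.kernel (C.path s) τ))
      (𝓝[D] (C.pt s)) (𝓝 J)) :
    Tendsto (fun x : Sphere2 => ∫ τ in (0 : ℝ)..C.N, C.kernel x τ) (𝓝[D] (C.pt s))
      (𝓝 ((∫ τ in (0 : ℝ)..C.N, C.kernel (C.path s) τ) + J)) := by
  obtain ⟨η, hη, hηN⟩ := (hJ.and (Ioo_mem_nhdsGT C.N_pos_real)).exists
  have hval : Tendsto (fun x : Sphere2 => (x : E3)) (𝓝[D] (C.pt s)) (𝓝 (C.path s)) :=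
    continuous_subtype_val.continuousAt.tendsto.mono_left nhdsWithin_le_nhds
  have hfar := (tendsto_integral_kernel_far (m := fun _ => 1) continuous_const hηN).comp hval
  have hnear := hη.add_const (∫ τ in (s - η)..(s + η), C.kernel (C.path s) τ)
  have hsplit (x : E3) := integral_kernel_near_add_far (C := C) (m := fun _ => 1)
    continuous_const (fun _ => rfl) x s η
  simp only [Function.comp_def, one_mul] at hfar hsplit
  have hsub (x : E3) := intervalIntegral.integral_sub
    (C.intervalIntegrable_kernel x (s - η) (s + η))
    (C.intervalIntegrable_kernel (C.path s) (s - η) (s + η))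
  simp only [hsub, sub_add_cancel] at hnear
  convert hnear.add hfar using 2
  · exact (hsplit _).symm
  · rw [← hsplit]
    ring

theorem doubleLayer_eq_integral_kernel (μ : Sphere2 → ℝ) {x : Sphere2} (hx : x ∉ C.carrier) :
    C.doubleLayer C.tangent μ x = ∫ τ in (0 : ℝ)..C.N, μ (C.pt τ) * C.kernel x τ := by
  rw [doubleLayer, lineIntegral, inter_univ, intervalIntegral.integral_of_le C.N_pos_real.le]
  exact setIntegral_congr_fun measurableSet_Ioc fun τ _ =>
    C.doubleLayerIntegrand_mul μ x fun h => hx ⟨τ, h⟩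

theorem doubleLayer_neg (t : ℝ → E3) (μ : Sphere2 → ℝ) (x : Sphere2) :
    C.doubleLayer (-t) μ x = -C.doubleLayer t μ x := by
  simp only [doubleLayer, lineIntegral, doubleLayerIntegrand, Pi.neg_apply, inner_neg_right,
    mul_neg, neg_mul, integral_neg]

variable {μ : Sphere2 → ℝ}

theorem continuous_density (hμ : ContinuousOn μ C.carrier) : Continuous fun τ => μ (C.pt τ) :=
  hμ.comp_continuous C.continuous_pt mem_range_self

theorem tendsto_truncK (hμ : ContinuousOn μ C.carrier) (s : ℝ) :
    Tendsto (C.truncK C.tangent μ (C.pt s)) (𝓝[>] 0)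
      (𝓝 (∫ τ in (0 : ℝ)..C.N, μ (C.pt τ) * C.kernel (C.path s) τ)) := by
  have hdist : Continuous fun τ => ‖C.path τ - C.path s‖ :=
    (C.continuous_path.sub continuous_const).norm
  have hcover : AECover (volume.restrict (Ioc 0 (C.N : ℝ))) (𝓝[>] (0 : ℝ))
      fun ε => {τ | ε ≤ ‖C.path τ - C.path s‖} :=
    ⟨ae_restrict_of_ae ((ae_path_ne s).mono fun τ hτ => nhdsWithin_le_nhds
      (Iic_mem_nhds (norm_pos_iff.2 (sub_ne_zero.2 hτ)))),
      fun ε => (isClosed_le continuous_const hdist).measurableSet⟩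
  have hint := (intervalIntegrable_iff_integrableOn_Ioc_of_le C.N_pos_real.le).1
    (intervalIntegrable_mul_kernel (C := C) (continuous_density hμ) (C.path s) 0 C.N)
  rw [intervalIntegral.integral_of_le C.N_pos_real.le]
  refine (hcover.integral_tendsto_of_countably_generated hint).congr' ?_
  filter_upwards [self_mem_nhdsWithin] with ε hε
  have hmeas := hcover.measurableSet ε
  rw [truncK, lineIntegral, Measure.restrict_restrict hmeas, inter_comm]
  refine setIntegral_congr_fun (measurableSet_Ioc.inter hmeas) fun τ hτ =>
    (C.doubleLayerIntegrand_mul μ (C.pt s) fun h => ?_).symm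
  refine (mem_Ioi.1 hε).not_ge (hτ.2.trans_eq ?_)
  rw [path, path, h, sub_self, norm_zero]

theorem tendsto_doubleLayer (hμ : ContinuousOn μ C.carrier) {D : Set Sphere2} {J : ℝ}
    (hD : Disjoint D C.carrier)
    (hJ : ∀ᶠ η in 𝓝[>] (0 : ℝ), Tendsto
      (fun x : Sphere2 => ∫ τ in (s - η)..(s + η), (C.kernel x τ - C.kernel (C.path s) τ))
      (𝓝[D] (C.pt s)) (𝓝 J)) :
    Tendsto (C.doubleLayer C.tangent μ) (𝓝[D] (C.pt s))
      (𝓝 ((∫ τ in (0 : ℝ)..C.N, μ (C.pt τ) * C.kernel (C.path s) τ) + J * μ (C.pt s))) := by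
  have hval : Tendsto (fun x : Sphere2 => (x : E3)) (𝓝[D] (C.pt s)) (𝓝 (C.path s)) :=
    continuous_subtype_val.continuousAt.tendsto.mono_left nhdsWithin_le_nhds
  have hμc : Continuous fun τ => μ (C.pt τ) - μ (C.pt s) :=
    (continuous_density hμ).sub continuous_const
  have hμper : Function.Periodic (fun τ => μ (C.pt τ) - μ (C.pt s)) C.N := fun τ => by
    simp only [C.periodic τ]
  have hlim := ((tendsto_integral_mul_kernel_of_eq_zero hμc hμper (sub_self _)).comp hval).add
    ((tendsto_integral_kernel hJ).const_mul (μ (C.pt s)))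
  have hsplit (x : E3) : (∫ τ in (0 : ℝ)..C.N, (μ (C.pt τ) - μ (C.pt s)) * C.kernel x τ) +
      μ (C.pt s) * ∫ τ in (0 : ℝ)..C.N, C.kernel x τ =
        ∫ τ in (0 : ℝ)..C.N, μ (C.pt τ) * C.kernel x τ := by
    rw [← intervalIntegral.integral_const_mul, ← intervalIntegral.integral_add
      (intervalIntegrable_mul_kernel hμc x _ _)
      ((C.intervalIntegrable_kernel x _ _).const_mul _)]
    simp only [sub_mul, sub_add_cancel]
  simp only [Function.comp_def, mul_add, ← add_assoc, hsplit] at hlim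
  rw [mul_comm J]
  refine hlim.congr' (eventually_nhdsWithin_of_forall fun x hx => ?_)
  exact (doubleLayer_eq_integral_kernel μ (disjoint_left.1 hD hx)).symm

end SphereCurve

/-! ### Stereographic projection -/

/-- Stereographic projection of the sphere from `-c` onto the complex plane spanned by `a` and
`c × a`, scaled so that the equator is mapped to the unit circle. -/
def stereo (a c y : E3) : ℂ := frameCoord a c y / ((1 + ⟪y, c⟫ : ℝ) : ℂ)

/-- The derivative at `y`, in the direction `v`, of the stereographic projection. -/
def stereoDeriv (a c y v : E3) : ℂ :=
  (frameCoord a c v - ⟪v, c⟫ * stereo a c y) / ((1 + ⟪y, c⟫ : ℝ) : ℂ)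

/-- The inverse of the stereographic projection. -/
def stereoInv (a c : E3) (z : ℂ) : E3 :=
  (1 + Complex.normSq z)⁻¹ • ((2 * z.re) • a + (2 * z.im) • cross c a +
    (1 - Complex.normSq z) • c)

theorem continuousAt_stereo {a c y : E3} (hy : 1 + ⟪y, c⟫ ≠ 0) : ContinuousAt (stereo a c) y := by
  refine (frameCoord a c).continuous.continuousAt.div ?_ (Complex.ofReal_ne_zero.2 hy)
  fun_prop

theorem continuousAt_stereoDeriv {a c y v : E3} (hy : 1 + ⟪y, c⟫ ≠ 0) :
    ContinuousAt (fun p : E3 × E3 => stereoDeriv a c p.1 p.2) (y, v) := by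
  have hstereo : ContinuousAt (fun p : E3 × E3 => stereo a c p.1) (y, v) :=
    ContinuousAt.comp (x := (y, v)) (f := Prod.fst) (continuousAt_stereo hy) continuousAt_fst
  have hinner : ContinuousAt (fun p : E3 × E3 => (⟪p.2, c⟫ : ℂ)) (y, v) := by fun_prop
  refine ContinuousAt.div ?_ (by fun_prop) (Complex.ofReal_ne_zero.2 hy)
  exact ((frameCoord a c).continuous.comp continuous_snd).continuousAt.sub (hinner.mul hstereo)

theorem continuous_stereoInv (a c : E3) : Continuous (stereoInv a c) := by
  have hinv : Continuous fun z : ℂ => (1 + Complex.normSq z)⁻¹ :=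
    (continuous_const.add Complex.continuous_normSq).inv₀ fun z =>
      (add_pos_of_pos_of_nonneg one_pos (Complex.normSq_nonneg z)).ne'
  exact hinv.smul (by fun_prop)

theorem hasDerivWithinAt_stereo (a c : E3) {f : ℝ → E3} {f' : E3} {S : Set ℝ} {τ : ℝ}
    (hf : HasDerivWithinAt f f' S τ) (hne : 1 + ⟪f τ, c⟫ ≠ 0) :
    HasDerivWithinAt (fun σ => stereo a c (f σ)) (stereoDeriv a c (f τ) f') S τ := by
  have hinner : HasDerivWithinAt (fun σ => ⟪f σ, c⟫) ⟪f', c⟫ S τ := by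
    simpa using hf.inner ℝ (hasDerivWithinAt_const τ S c)
  have hnum := (frameCoord a c).hasFDerivAt.comp_hasDerivWithinAt τ hf
  have hquot := hnum.div (hinner.const_add 1).ofReal_comp (Complex.ofReal_ne_zero.2 hne)
  refine hquot.congr_deriv ?_
  have hne' := Complex.ofReal_ne_zero.2 hne
  simp only [stereoDeriv, stereo, Function.comp_apply]
  field_simp

theorem frameCoord_eq_mul_stereo {a c y : E3} (hy : 1 + ⟪y, c⟫ ≠ 0) :
    frameCoord a c y = ((1 + ⟪y, c⟫ : ℝ) : ℂ) * stereo a c y := by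
  rw [stereo, mul_div_cancel₀ _ (Complex.ofReal_ne_zero.2 hy)]

theorem frameCoord_eq_stereoDeriv {a c y : E3} (v : E3) (hy : 1 + ⟪y, c⟫ ≠ 0) :
    frameCoord a c v = ((1 + ⟪y, c⟫ : ℝ) : ℂ) * stereoDeriv a c y v + ⟪v, c⟫ * stereo a c y := by
  rw [stereoDeriv, mul_div_cancel₀ _ (Complex.ofReal_ne_zero.2 hy), sub_add_cancel]

namespace IsFrame

variable {a c x y u v : E3}

theorem stereo_self (h : IsFrame a c) : stereo a c c = 0 := by
  have : frameCoord a c c = 0 := Complex.ext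
    (by rw [frameCoord_re, real_inner_comm, h.inner_eq_zero, Complex.zero_re])
    (by rw [frameCoord_im, inner_cross_left_self, Complex.zero_im])
  rw [stereo, this, zero_div]

theorem stereoDeriv_self (h : IsFrame a c) (v : E3) :
    stereoDeriv a c c v = ((2⁻¹ : ℝ) : ℂ) * frameCoord a c v := by
  rw [stereoDeriv, h.stereo_self, h.inner_snd_self]
  push_cast
  ring

theorem inner_eq_re (h : IsFrame a c) (u v : E3) :
    ⟪u, v⟫ = (conj (frameCoord a c u) * frameCoord a c v).re + ⟪u, c⟫ * ⟪v, c⟫ := by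
  rw [h.conj_frameCoord_mul, sub_add_cancel]

theorem mul_one_add_normSq_stereo (h : IsFrame a c) (hy : ‖y‖ = 1) (hyc : 1 + ⟪y, c⟫ ≠ 0) :
    (1 + ⟪y, c⟫) * (1 + Complex.normSq (stereo a c y)) = 2 := by
  have hnorm := h.inner_eq_re y y
  rw [real_inner_self_eq_norm_sq, hy, frameCoord_eq_mul_stereo hyc] at hnorm
  refine mul_left_cancel₀ hyc ?_
  simp only [map_mul, Complex.conj_ofReal, Complex.mul_re, Complex.mul_im, Complex.conj_re,
    Complex.conj_im, Complex.ofReal_re, Complex.ofReal_im, Complex.normSq_apply] at hnorm ⊢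
  linear_combination -hnorm

theorem norm_sub_sq_eq_normSq_stereo_sub (h : IsFrame a c) (hx : ‖x‖ = 1) (hy : ‖y‖ = 1)
    (hxc : 1 + ⟪x, c⟫ ≠ 0) (hyc : 1 + ⟪y, c⟫ ≠ 0) :
    ‖x - y‖ ^ 2 = (1 + ⟪x, c⟫) * (1 + ⟪y, c⟫) *
      Complex.normSq (stereo a c y - stereo a c x) := by
  have hx₂ := h.mul_one_add_normSq_stereo hx hxc
  have hy₂ := h.mul_one_add_normSq_stereo hy hyc
  rw [norm_sub_sq_of_norm_eq_one hx hy, h.inner_eq_re, frameCoord_eq_mul_stereo hxc,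
    frameCoord_eq_mul_stereo hyc]
  simp only [map_mul, Complex.conj_ofReal, Complex.mul_re, Complex.mul_im, Complex.conj_re,
    Complex.conj_im, Complex.ofReal_re, Complex.ofReal_im, Complex.normSq_apply, Complex.sub_re,
    Complex.sub_im] at hx₂ hy₂ ⊢
  linear_combination -(1 + ⟪y, c⟫) * hx₂ - (1 + ⟪x, c⟫) * hy₂

theorem inner_snd_eq_stereoDeriv (h : IsFrame a c) (hy : ‖y‖ = 1) (hyc : 1 + ⟪y, c⟫ ≠ 0)
    (hyu : ⟪y, u⟫ = 0) :
    ⟪u, c⟫ = -(1 + ⟪y, c⟫) ^ 2 * (conj (stereo a c y) * stereoDeriv a c y u).re := by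
  have hy₂ := h.mul_one_add_normSq_stereo hy hyc
  rw [h.inner_eq_re, frameCoord_eq_mul_stereo hyc, frameCoord_eq_stereoDeriv u hyc] at hyu
  simp only [map_mul, Complex.conj_ofReal, Complex.mul_re, Complex.mul_im, Complex.conj_re,
    Complex.conj_im, Complex.add_re, Complex.add_im, Complex.ofReal_re, Complex.ofReal_im,
    Complex.normSq_apply] at hyu hy₂ ⊢
  linear_combination hyu - ⟪u, c⟫ * hy₂

/-- The stereographic projection is conformal and preserves the orientation. -/
theorem stereoDeriv_cross (h : IsFrame a c) (hy : ‖y‖ = 1) (hyc : 1 + ⟪y, c⟫ ≠ 0)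
    (hyv : ⟪y, v⟫ = 0) : stereoDeriv a c y (cross y v) = Complex.I * stereoDeriv a c y v := by
  have hy₂ := h.mul_one_add_normSq_stereo hy hyc
  have hv := h.inner_snd_eq_stereoDeriv hy hyc hyv
  have hcross : ⟪cross y v, c⟫ =
      (1 + ⟪y, c⟫) ^ 2 * (conj (stereo a c y) * stereoDeriv a c y v).im := by
    have him := congrArg Complex.im (h.conj_frameCoord_mul y v)
    rw [frameCoord_eq_mul_stereo hyc, frameCoord_eq_stereoDeriv v hyc] at him
    simp only [map_mul, Complex.conj_ofReal, Complex.mul_re, Complex.mul_im, Complex.conj_re,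
      Complex.conj_im, Complex.add_re, Complex.add_im, Complex.ofReal_re, Complex.ofReal_im]
      at him ⊢
    linear_combination -him
  refine mul_left_cancel₀ (Complex.ofReal_ne_zero.2 hyc) ?_
  rw [eq_sub_of_add_eq (frameCoord_eq_stereoDeriv (cross y v) hyc).symm, h.frameCoord_cross,
    frameCoord_eq_mul_stereo hyc, frameCoord_eq_stereoDeriv v hyc, hcross, hv]
  apply Complex.ext <;>
    simp only [Complex.mul_re, Complex.mul_im, Complex.conj_re, Complex.conj_im, Complex.add_re,
      Complex.add_im, Complex.sub_re, Complex.sub_im, Complex.ofReal_re, Complex.ofReal_im,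
      Complex.normSq_apply, Complex.I_re, Complex.I_im] at hy₂ ⊢
  · linear_combination -(1 + ⟪y, c⟫) * (stereoDeriv a c y v).im * hy₂
  · linear_combination (1 + ⟪y, c⟫) * (stereoDeriv a c y v).re * hy₂

theorem inner_eq_stereo (h : IsFrame a c) (hx : ‖x‖ = 1) (hy : ‖y‖ = 1)
    (hxc : 1 + ⟪x, c⟫ ≠ 0) (hyc : 1 + ⟪y, c⟫ ≠ 0) (hyu : ⟪y, u⟫ = 0) :
    ⟪x, u⟫ = (1 + ⟪x, c⟫) * (1 + ⟪y, c⟫) *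
      ((conj (stereo a c y) * stereoDeriv a c y u).re *
          Complex.normSq (stereo a c y - stereo a c x) / (1 + Complex.normSq (stereo a c y)) -
        (conj (stereo a c y - stereo a c x) * stereoDeriv a c y u).re) := by
  have hx₂ := h.mul_one_add_normSq_stereo hx hxc
  have hy₂ := h.mul_one_add_normSq_stereo hy hyc
  have hdiv : (1 + Complex.normSq (stereo a c y))⁻¹ = (1 + ⟪y, c⟫) / 2 := by
    rw [← hy₂]
    field_simp
  rw [h.inner_eq_re, frameCoord_eq_mul_stereo hxc, frameCoord_eq_stereoDeriv u hyc,
    h.inner_snd_eq_stereoDeriv hy hyc hyu, div_eq_mul_inv, hdiv]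
  simp only [map_mul, map_sub, Complex.conj_ofReal, Complex.mul_re, Complex.mul_im,
    Complex.conj_re, Complex.conj_im, Complex.add_re, Complex.add_im, Complex.sub_re,
    Complex.sub_im, Complex.ofReal_re, Complex.ofReal_im, Complex.normSq_apply] at hx₂ hy₂ ⊢
  linear_combination -((1 + ⟪y, c⟫) / 2 * ((stereo a c y).re * (stereoDeriv a c y u).re +
    (stereo a c y).im * (stereoDeriv a c y u).im)) *
      ((1 + ⟪x, c⟫) * hy₂ + (1 + ⟪y, c⟫) * hx₂)

theorem inner_cross_div_eq_stereo (h : IsFrame a c) (hx : ‖x‖ = 1) (hy : ‖y‖ = 1)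
    (hxc : 1 + ⟪x, c⟫ ≠ 0) (hyc : 1 + ⟪y, c⟫ ≠ 0) (hyv : ⟪y, v⟫ = 0)
    (hxy : stereo a c y ≠ stereo a c x) :
    ⟪cross x y, v⟫ / ‖x - y‖ ^ 2 =
      (stereoDeriv a c y v / (stereo a c y - stereo a c x)).im -
        (conj (stereo a c y) * stereoDeriv a c y v).im /
          (1 + Complex.normSq (stereo a c y)) := by
  have hD : Complex.normSq (stereo a c y - stereo a c x) ≠ 0 :=
    Complex.normSq_eq_zero.not.2 (sub_ne_zero.2 hxy)
  have hq : 1 + Complex.normSq (stereo a c y) ≠ 0 :=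
    (add_pos_of_pos_of_nonneg one_pos (Complex.normSq_nonneg _)).ne'
  have hre (z w : ℂ) : (conj z * (Complex.I * w)).re = -(conj z * w).im := by
    rw [mul_left_comm, Complex.I_mul_re]
  have hdiv (z w : ℂ) : (w / z).im = (conj z * w).im / Complex.normSq z := by
    rw [mul_comm, div_eq_mul_inv, Complex.inv_def, ← mul_assoc, Complex.im_mul_ofReal,
      div_eq_mul_inv]
  rw [inner_cross_rotate, real_inner_comm, h.inner_eq_stereo hx hy hxc hyc (u := cross y v)
    (by rw [real_inner_comm, inner_cross_left_self]), h.stereoDeriv_cross hy hyc hyv,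
    h.norm_sub_sq_eq_normSq_stereo_sub hx hy hxc hyc, hre, hre, hdiv]
  field_simp
  ring

theorem inner_stereoInv_snd (h : IsFrame a c) (z : ℂ) :
    1 + ⟪stereoInv a c z, c⟫ = 2 / (1 + Complex.normSq z) := by
  have hz : 1 + Complex.normSq z ≠ 0 :=
    (add_pos_of_pos_of_nonneg one_pos (Complex.normSq_nonneg z)).ne'
  simp only [stereoInv, real_inner_smul_left, inner_add_left, inner_cross_left_self,
    h.inner_snd_self, real_inner_comm c a, h.inner_eq_zero]
  field_simp
  ring

theorem one_add_inner_stereoInv_pos (h : IsFrame a c) (z : ℂ) :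
    0 < 1 + ⟪stereoInv a c z, c⟫ := by
  rw [h.inner_stereoInv_snd]
  exact div_pos two_pos (add_pos_of_pos_of_nonneg one_pos (Complex.normSq_nonneg z))

theorem frameCoord_stereoInv (h : IsFrame a c) (z : ℂ) :
    frameCoord a c (stereoInv a c z) = ((2 / (1 + Complex.normSq z) : ℝ) : ℂ) * z := by
  have hac : ⟪a, c⟫ = 0 := by rw [real_inner_comm, h.inner_eq_zero]
  have hcross : ⟪a, cross c a⟫ = 0 := by rw [real_inner_comm, inner_cross_right_self]
  apply Complex.ext
  · simp only [frameCoord_re, stereoInv, real_inner_smul_right, inner_add_right,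
      h.inner_fst_self, hac, hcross, Complex.re_ofReal_mul]
    ring
  · simp only [frameCoord_im, stereoInv, real_inner_smul_right, inner_add_right,
      real_inner_self_eq_norm_sq, h.norm_cross, inner_cross_left_self, inner_cross_right_self,
      Complex.im_ofReal_mul]
    ring

theorem stereo_stereoInv (h : IsFrame a c) (z : ℂ) : stereo a c (stereoInv a c z) = z := by
  have hne := (h.one_add_inner_stereoInv_pos z).ne'
  rw [stereo, h.frameCoord_stereoInv, ← h.inner_stereoInv_snd,
    mul_div_cancel_left₀ _ (Complex.ofReal_ne_zero.2 hne)]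

theorem norm_stereoInv (h : IsFrame a c) (z : ℂ) : ‖stereoInv a c z‖ = 1 := by
  have hz : 1 + Complex.normSq z ≠ 0 :=
    (add_pos_of_pos_of_nonneg one_pos (Complex.normSq_nonneg z)).ne'
  have hinner := h.inner_eq_re (stereoInv a c z) (stereoInv a c z)
  rw [h.frameCoord_stereoInv, eq_sub_of_add_eq' (h.inner_stereoInv_snd z),
    real_inner_self_eq_norm_sq, map_mul, Complex.conj_ofReal, mul_mul_mul_comm,
    ← Complex.normSq_eq_conj_mul_self, ← Complex.ofReal_mul, ← Complex.ofReal_mul,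
    Complex.ofReal_re] at hinner
  rw [← pow_eq_one_iff_of_nonneg (norm_nonneg _) two_ne_zero, hinner]
  field_simp
  ring

theorem stereoInv_stereo (h : IsFrame a c) (hy : ‖y‖ = 1) (hyc : 1 + ⟪y, c⟫ ≠ 0) :
    stereoInv a c (stereo a c y) = y := by
  have hdist := h.norm_sub_sq_eq_normSq_stereo_sub (h.norm_stereoInv (stereo a c y)) hy
    (h.one_add_inner_stereoInv_pos _).ne' hyc
  rwa [h.stereo_stereoInv, sub_self, map_zero, mul_zero, sq_eq_zero_iff, norm_eq_zero,
    sub_eq_zero] at hdist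

end IsFrame

/-! ### The argument along a path in the complex plane -/

theorem hasDerivAt_arg {f : ℝ → ℂ} {f' : ℂ} {τ : ℝ} (hf : HasDerivAt f f' τ)
    (h : f τ ∈ Complex.slitPlane) : HasDerivAt (fun σ => (f σ).arg) (f' / f τ).im τ := by
  simpa only [Function.comp_def, Complex.imCLM_apply, Complex.log_im] using
    Complex.imCLM.hasFDerivAt.comp_hasDerivAt τ (hf.clog_real h)

theorem hasDerivAt_arg_const_mul {f : ℝ → ℂ} {f' u : ℂ} {τ : ℝ} (hf : HasDerivAt f f' τ)
    (h : u * f τ ∈ Complex.slitPlane) :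
    HasDerivAt (fun σ => (u * f σ).arg) (f' / f τ).im τ := by
  have hu : u ≠ 0 := left_ne_zero_of_mul (Complex.slitPlane_ne_zero h)
  simpa only [mul_div_mul_left _ _ hu] using hasDerivAt_arg (hf.const_mul u) h

theorem tendsto_arg_of_hasDerivWithinAt {f : ℝ → ℂ} {f' : ℂ} {s : ℝ} {S : Set ℝ} {ε : ℝ}
    (hf : HasDerivWithinAt f f' S s) (hfs : f s = 0) (hf' : f' ∈ Complex.slitPlane)
    (hS : ∀ τ ∈ S \ {s}, 0 < ε * (τ - s)) :
    Tendsto (fun τ => (ε * f τ).arg) (𝓝[S \ {s}] s) (𝓝 f'.arg) := by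
  refine ((Complex.continuousAt_arg hf').tendsto.comp
    (hasDerivWithinAt_iff_tendsto_slope.1 hf)).congr' ?_
  filter_upwards [self_mem_nhdsWithin] with τ hτ
  have hpos := hS τ hτ
  have hslope : (ε : ℂ) * f τ = ((ε * (τ - s) : ℝ) : ℂ) * slope f s τ := by
    rw [slope_def_module, hfs, sub_zero, Complex.real_smul]
    have : ((τ - s : ℝ) : ℂ) ≠ 0 := Complex.ofReal_ne_zero.2 (right_ne_zero_of_mul hpos.ne')
    push_cast at this ⊢
    field_simp
  rw [Function.comp_apply, hslope, Complex.arg_real_mul _ hpos]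

theorem integral_eq_arg_sub_arg {f f' : ℝ → ℂ} {k : ℝ → ℝ} {X u w : ℂ} {A B α β : ℝ} (hAB : A < B)
    (hf : ∀ τ ∈ Icc A B, ContinuousAt f τ) (hf' : ∀ τ ∈ Ioo A B, HasDerivAt f (f' τ) τ)
    (hu : ∀ τ ∈ Icc A B, u * (f τ - X) ∈ Complex.slitPlane)
    (hw : ∀ τ ∈ Ioo A B, w * f τ ∈ Complex.slitPlane)
    (hk : ∀ τ ∈ Ioo A B, k τ = (f' τ / (f τ - X)).im - (f' τ / f τ).im)
    (hint : IntervalIntegrable k volume A B)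
    (hα : Tendsto (fun τ => (w * f τ).arg) (𝓝[>] A) (𝓝 α))
    (hβ : Tendsto (fun τ => (w * f τ).arg) (𝓝[<] B) (𝓝 β)) :
    ∫ τ in A..B, k τ = ((u * (f B - X)).arg - β) - ((u * (f A - X)).arg - α) := by
  have harg (τ : ℝ) (hτ : τ ∈ Icc A B) : ContinuousAt (fun τ => (u * (f τ - X)).arg) τ :=
    ContinuousAt.comp (g := Complex.arg) (Complex.continuousAt_arg (hu τ hτ))
      (continuousAt_const.mul ((hf τ hτ).sub continuousAt_const))
  refine intervalIntegral.integral_eq_sub_of_hasDerivAt_of_tendsto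
    (f := fun τ => (u * (f τ - X)).arg - (w * f τ).arg) hAB (fun τ hτ => ?_) hint ?_ ?_
  · rw [hk τ hτ]
    exact (hasDerivAt_arg_const_mul ((hf' τ hτ).sub_const X)
      (hu τ (Ioo_subset_Icc_self hτ))).sub (hasDerivAt_arg_const_mul (hf' τ hτ) (hw τ hτ))
  · exact ((harg A (left_mem_Icc.2 hAB.le)).tendsto.mono_left nhdsWithin_le_nhds).sub hα
  · exact ((harg B (right_mem_Icc.2 hAB.le)).tendsto.mono_left nhdsWithin_le_nhds).sub hβ

/-! ### The curve as a graph in the stereographic chart -/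

theorem eventually_forall_mem_Icc_sub_add {P : ℝ → Prop} {s : ℝ} (h : ∀ᶠ τ in 𝓝 s, P τ) :
    ∀ᶠ η in 𝓝[>] (0 : ℝ), ∀ τ ∈ Icc (s - η) (s + η), P τ := by
  obtain ⟨δ, hδ, hP⟩ := Metric.eventually_nhds_iff_ball.1 h
  filter_upwards [Ioo_mem_nhdsGT hδ] with η hη τ hτ
  rw [Real.ball_eq_Ioo] at hP
  exact hP τ ⟨by linarith [hτ.1, hη.2], by linarith [hτ.2, hη.2]⟩

namespace SphereCurve

/-- The curve in the stereographic chart centred at its point with parameter `s`, where the real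
axis points in the direction `a`. -/
def chart (C : SphereCurve) (a : E3) (s τ : ℝ) : ℂ := stereo a (C.path s) (C.path τ)

/-- The derivative of `chart` with respect to `τ`. -/
def chartDeriv (C : SphereCurve) (a : E3) (s τ : ℝ) : ℂ :=
  stereoDeriv a (C.path s) (C.path τ) (deriv C.path τ)

/-- The piece of the curve with parameters in `[s - η, s + η]` is a graph over the real axis in
the chart centred at the point with parameter `s`, and it has no corner except possibly at that
point. -/
structure IsLocalGraph (C : SphereCurve) (s : ℝ) (a : E3) (η : ℝ) : Prop
    extends C.IsTransversal s a where
  pos : 0 < η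
  denom_pos : ∀ τ ∈ Icc (s - η) (s + η), 0 < 1 + ⟪C.path τ, C.path s⟫
  contDiffAt : ∀ τ ∈ Icc (s - η) (s + η), τ ≠ s → ContDiffAt ℝ 2 C.path τ
  deriv_re_pos : ∀ τ ∈ Icc (s - η) (s + η), τ ≠ s → 0 < (C.chartDeriv a s τ).re

variable {C : SphereCurve} {s η τ : ℝ} {a : E3}

theorem one_add_inner_self (s : ℝ) : 1 + ⟪C.path s, C.path s⟫ = 2 := by
  rw [real_inner_self_eq_norm_sq, C.norm_path]
  norm_num

theorem eventually_one_add_inner_pos (s : ℝ) : ∀ᶠ y in 𝓝 (C.path s), 0 < 1 + ⟪y, C.path s⟫ := by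
  have hcont : Continuous fun y : E3 => 1 + ⟪y, C.path s⟫ := by fun_prop
  exact hcont.continuousAt.eventually_const_lt (by simp only [one_add_inner_self, two_pos])

theorem continuousAt_chart (h : 1 + ⟪C.path τ, C.path s⟫ ≠ 0) : ContinuousAt (C.chart a s) τ :=
  ContinuousAt.comp (g := stereo a (C.path s)) (continuousAt_stereo h)
    C.continuous_path.continuousAt

theorem hasDerivAt_chart (hd : DifferentiableAt ℝ C.path τ) (h : 1 + ⟪C.path τ, C.path s⟫ ≠ 0) :
    HasDerivAt (C.chart a s) (C.chartDeriv a s τ) τ :=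
  (hasDerivWithinAt_stereo a (C.path s) hd.hasDerivAt.hasDerivWithinAt h).hasDerivAt univ_mem

namespace IsTransversal

variable (h : C.IsTransversal s a)
include h

theorem chart_self : C.chart a s s = 0 := h.stereo_self

theorem frameCoord_rightDeriv_re_pos : 0 < (frameCoord a (C.path s) (C.rightDeriv s)).re := by
  rw [frameCoord_re]
  exact h.inner_rightDeriv_pos

theorem frameCoord_leftDeriv_re_pos : 0 < (frameCoord a (C.path s) (C.leftDeriv s)).re := by
  rw [frameCoord_re]
  exact h.inner_leftDeriv_pos

theorem eventually_chartDeriv_re_pos_of_tendsto {v : E3} {l : Filter ℝ} (hl : l ≤ 𝓝 s)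
    (hv : Tendsto (deriv C.path) l (𝓝 v)) (hpos : 0 < ⟪a, v⟫) :
    ∀ᶠ τ in l, 0 < (C.chartDeriv a s τ).re := by
  have hne : 1 + ⟪C.path s, C.path s⟫ ≠ 0 := (one_add_inner_self s).trans_ne two_ne_zero
  have hpair : Tendsto (fun τ => (C.path τ, deriv C.path τ)) l (𝓝 (C.path s, v)) :=
    (C.continuous_path.continuousAt.tendsto.mono_left hl).prodMk_nhds hv
  have hlim := (Complex.continuous_re.tendsto _).comp
    ((continuousAt_stereoDeriv (a := a) hne).tendsto.comp hpair)
  refine hlim.eventually_const_lt ?_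
  rw [h.stereoDeriv_self, Complex.re_ofReal_mul, frameCoord_re]
  positivity

theorem eventually_isLocalGraph : ∀ᶠ η in 𝓝[>] (0 : ℝ), C.IsLocalGraph s a η := by
  have hderiv : ∀ᶠ τ in 𝓝[≠] s, 0 < (C.chartDeriv a s τ).re := by
    rw [← nhdsLT_sup_nhdsGT, eventually_sup]
    exact ⟨h.eventually_chartDeriv_re_pos_of_tendsto nhdsWithin_le_nhds (C.tendsto_deriv_left s)
        h.inner_leftDeriv_pos,
      h.eventually_chartDeriv_re_pos_of_tendsto nhdsWithin_le_nhds (C.tendsto_deriv_right s)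
        h.inner_rightDeriv_pos⟩
  filter_upwards [self_mem_nhdsWithin, eventually_forall_mem_Icc_sub_add
      (C.continuous_path.continuousAt.eventually (eventually_one_add_inner_pos s)),
    eventually_forall_mem_Icc_sub_add (eventually_nhdsWithin_iff.1 (C.eventually_contDiffAt s)),
    eventually_forall_mem_Icc_sub_add (eventually_nhdsWithin_iff.1 hderiv)]
    with η hη hdenom hsmooth hpos
  exact ⟨h, hη, hdenom, hsmooth, hpos⟩

end IsTransversal

namespace IsLocalGraph

variable (h : C.IsLocalGraph s a η)
include h

theorem self_mem_Icc : s ∈ Icc (s - η) (s + η) := by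
  constructor <;> linarith [h.pos]

theorem continuousAt_chart (hτ : τ ∈ Icc (s - η) (s + η)) : ContinuousAt (C.chart a s) τ :=
  SphereCurve.continuousAt_chart (h.denom_pos τ hτ).ne'

theorem hasDerivAt_chart (hτ : τ ∈ Icc (s - η) (s + η)) (hne : τ ≠ s) :
    HasDerivAt (C.chart a s) (C.chartDeriv a s τ) τ :=
  SphereCurve.hasDerivAt_chart ((h.contDiffAt τ hτ hne).differentiableAt two_ne_zero)
    (h.denom_pos τ hτ).ne'

theorem strictMonoOn_chart_re_of_subset {A B : ℝ} (hsub : Icc A B ⊆ Icc (s - η) (s + η))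
    (hs : s ∉ Ioo A B) : StrictMonoOn (fun τ => (C.chart a s τ).re) (Icc A B) := by
  refine strictMonoOn_of_hasDerivWithinAt_pos (f' := fun τ => (C.chartDeriv a s τ).re)
    (convex_Icc A B) (fun τ hτ => ?_) (fun τ hτ => ?_) fun τ hτ => ?_
  · exact (Complex.continuous_re.continuousAt.comp
      (h.continuousAt_chart (hsub hτ))).continuousWithinAt
  all_goals
    have hne : τ ≠ s := by
      rintro rfl
      exact hs (by rwa [interior_Icc] at hτ)
  · exact (Complex.reCLM.hasFDerivAt.comp_hasDerivAt τ
      (h.hasDerivAt_chart (hsub (interior_subset hτ)) hne)).hasDerivWithinAt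
  · exact h.deriv_re_pos τ (hsub (interior_subset hτ)) hne

theorem strictMonoOn_chart_re :
    StrictMonoOn (fun τ => (C.chart a s τ).re) (Icc (s - η) (s + η)) := by
  have hη := h.pos
  rw [← Icc_union_Icc_eq_Icc (sub_le_self s hη.le) (le_add_of_nonneg_right hη.le)]
  refine (h.strictMonoOn_chart_re_of_subset (Icc_subset_Icc_right (by linarith)) ?_).union
    (h.strictMonoOn_chart_re_of_subset (Icc_subset_Icc_left (by linarith)) ?_)
    (isGreatest_Icc (by linarith)) (isLeast_Icc (by linarith))
  · exact fun hs => hs.2.false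
  · exact fun hs => hs.1.false

theorem chart_re_pos (hτ : τ ∈ Ioc s (s + η)) : 0 < (C.chart a s τ).re := by
  have := h.strictMonoOn_chart_re h.self_mem_Icc ⟨by linarith [h.pos, hτ.1], hτ.2⟩ hτ.1
  simpa [h.chart_self] using this

theorem chart_re_neg (hτ : τ ∈ Ico (s - η) s) : (C.chart a s τ).re < 0 := by
  have := h.strictMonoOn_chart_re ⟨hτ.1, by linarith [h.pos, hτ.2]⟩ h.self_mem_Icc hτ.2
  simpa [h.chart_self] using this

end IsLocalGraph

end SphereCurve

/-! ### The jump of the kernel integral at a point of the curve -/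

theorem arg_mul_I_mul_of_re_pos {σ : ℝ} {z : ℂ} (hσ : σ = 1 ∨ σ = -1) (hz : 0 < z.re) :
    (σ * Complex.I * z).arg = z.arg + σ * (Real.pi / 2) := by
  have hI : (σ * Complex.I).arg = σ * (Real.pi / 2) := by
    rcases hσ with rfl | rfl <;> simp
  have hz' := abs_lt.1 (Complex.abs_arg_lt_pi_div_two_iff.2 (Or.inl hz))
  rw [Complex.arg_mul _ (by rintro rfl; simp at hz), hI, add_comm]
  · rw [hI]
    rcases hσ with rfl | rfl <;> constructor <;> linarith
  · rcases hσ with rfl | rfl <;> simp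

theorem arg_mul_I_mul_sub_arg {σ ε : ℝ} {z : ℂ} (hσ : σ = 1 ∨ σ = -1) (hε : ε = 1 ∨ ε = -1)
    (hz : 0 < ε * z.re) :
    (σ * Complex.I * z).arg - (ε * z).arg = σ * ε * (Real.pi / 2) := by
  have hσε : σ * ε = 1 ∨ σ * ε = -1 := by
    rcases hσ with rfl | rfl <;> rcases hε with rfl | rfl <;> simp
  have hmul : ((σ * ε : ℝ) : ℂ) * Complex.I * (ε * z) = σ * Complex.I * z := by
    rcases hε with rfl | rfl <;> push_cast <;> ring
  rw [← hmul, arg_mul_I_mul_of_re_pos hσε (by rwa [Complex.re_ofReal_mul]), add_sub_cancel_left]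

namespace SphereCurve

/-- The points of the sphere that lie above (`σ = 1`) or below (`σ = -1`) the piece of the curve
with parameters in `[s - η, s + η]`, in the chart centred at its midpoint. The condition is only
imposed where the piece meets the vertical line through the point. -/
def graphSide (C : SphereCurve) (s : ℝ) (a : E3) (η σ : ℝ) : Set Sphere2 :=
  {x | ∀ τ ∈ Icc (s - η) (s + η), (C.chart a s τ).re = (stereo a (C.path s) x).re →
    0 < σ * ((stereo a (C.path s) x).im - (C.chart a s τ).im)}

variable {C : SphereCurve} {s η τ σ : ℝ} {a : E3} {x : Sphere2}

theorem mul_sub_mem_slitPlane_of_mem_graphSide (hσ : σ ≠ 0) (hx : x ∈ C.graphSide s a η σ)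
    (hτ : τ ∈ Icc (s - η) (s + η)) :
    (σ * Complex.I) * (C.chart a s τ - stereo a (C.path s) x) ∈ Complex.slitPlane := by
  rw [Complex.mem_slitPlane_iff]
  simp only [mul_assoc, Complex.re_ofReal_mul, Complex.im_ofReal_mul, Complex.I_mul_re,
    Complex.I_mul_im, Complex.sub_re, Complex.sub_im]
  by_cases hre : (C.chart a s τ).re = (stereo a (C.path s) x).re
  · left
    linarith [hx τ hτ hre]
  · exact Or.inr (mul_ne_zero hσ (sub_ne_zero.2 hre))

namespace IsTransversal

variable (h : C.IsTransversal s a)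
include h

theorem tendsto_stereo :
    Tendsto (fun x : Sphere2 => stereo a (C.path s) x) (𝓝 (C.pt s)) (𝓝 0) := by
  rw [← h.stereo_self]
  exact (continuousAt_stereo ((one_add_inner_self s).trans_ne two_ne_zero)).tendsto.comp
    continuous_subtype_val.continuousAt

theorem tendsto_arg_chart_right :
    Tendsto (fun τ => (((1 : ℝ) : ℂ) * C.chart a s τ).arg) (𝓝[>] s)
      (𝓝 (frameCoord a (C.path s) (C.rightDeriv s)).arg) := by
  have hderiv := hasDerivWithinAt_stereo a (C.path s) (C.hasDerivWithinAt_rightDeriv s)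
    ((one_add_inner_self s).trans_ne two_ne_zero)
  rw [h.stereoDeriv_self] at hderiv
  have hlim := tendsto_arg_of_hasDerivWithinAt (ε := 1) hderiv h.chart_self
    (Or.inl (by rw [Complex.re_ofReal_mul]; have := h.frameCoord_rightDeriv_re_pos; positivity))
    fun τ hτ => by linarith [lt_of_le_of_ne (mem_Ici.1 hτ.1) (Ne.symm hτ.2)]
  rwa [Complex.arg_real_mul _ (by norm_num), Ici_sdiff_left] at hlim

theorem tendsto_arg_chart_left :
    Tendsto (fun τ => (((-1 : ℝ) : ℂ) * C.chart a s τ).arg) (𝓝[<] s)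
      (𝓝 (frameCoord a (C.path s) (C.leftDeriv s)).arg) := by
  have hderiv := hasDerivWithinAt_stereo a (C.path s) (C.hasDerivWithinAt_leftDeriv s)
    ((one_add_inner_self s).trans_ne two_ne_zero)
  rw [h.stereoDeriv_self] at hderiv
  have hlim := tendsto_arg_of_hasDerivWithinAt (ε := -1) hderiv h.chart_self
    (Or.inl (by rw [Complex.re_ofReal_mul]; have := h.frameCoord_leftDeriv_re_pos; positivity))
    fun τ hτ => by linarith [lt_of_le_of_ne (mem_Iic.1 hτ.1) hτ.2]
  rwa [Complex.arg_real_mul _ (by norm_num), Iic_sdiff_right] at hlim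

end IsTransversal

namespace IsLocalGraph

variable (h : C.IsLocalGraph s a η)
include h

theorem chart_ne_zero (hτ : τ ∈ Icc (s - η) (s + η)) (hne : τ ≠ s) : C.chart a s τ ≠ 0 := fun h0 =>
  hne (h.strictMonoOn_chart_re.injOn hτ h.self_mem_Icc (by simp only [h0, h.chart_self]))

theorem two_pi_mul_kernel_sub_kernel (hxs : 1 + ⟪(x : E3), C.path s⟫ ≠ 0)
    (hτ : τ ∈ Icc (s - η) (s + η)) (hne : τ ≠ s)
    (hx : C.chart a s τ ≠ stereo a (C.path s) x) :
    2 * Real.pi * (C.kernel x τ - C.kernel (C.path s) τ) =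
      (C.chartDeriv a s τ / (C.chart a s τ - stereo a (C.path s) x)).im -
        (C.chartDeriv a s τ / C.chart a s τ).im := by
  have hτs := (h.denom_pos τ hτ).ne'
  have hkx := h.inner_cross_div_eq_stereo (norm_eq_of_mem_sphere x) (C.norm_path τ) hxs hτs
    (C.inner_path_deriv τ) hx
  have hks := h.inner_cross_div_eq_stereo (C.norm_path s) (C.norm_path τ)
    ((one_add_inner_self s).trans_ne two_ne_zero) hτs (C.inner_path_deriv τ)
    (by rw [h.stereo_self]; exact h.chart_ne_zero hτ hne)
  rw [h.stereo_self, sub_zero] at hks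
  rw [kernel, kernel, hkx, hks, chart, chartDeriv]
  field_simp
  ring

theorem integral_kernel_sub_kernel (hσ : σ ≠ 0) (hxs : 1 + ⟪(x : E3), C.path s⟫ ≠ 0)
    (hx : x ∈ C.graphSide s a η σ) {A B α β ε : ℝ} (hAB : A < B)
    (hsub : Icc A B ⊆ Icc (s - η) (s + η)) (hpos : ∀ τ ∈ Ioo A B, 0 < ε * (C.chart a s τ).re)
    (hα : Tendsto (fun τ => (ε * C.chart a s τ).arg) (𝓝[>] A) (𝓝 α))
    (hβ : Tendsto (fun τ => (ε * C.chart a s τ).arg) (𝓝[<] B) (𝓝 β)) :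
    2 * Real.pi * ∫ τ in A..B, (C.kernel x τ - C.kernel (C.path s) τ) =
      ((σ * Complex.I * (C.chart a s B - stereo a (C.path s) x)).arg - β) -
        ((σ * Complex.I * (C.chart a s A - stereo a (C.path s) x)).arg - α) := by
  have hslit (τ : ℝ) (hτ : τ ∈ Icc A B) :=
    mul_sub_mem_slitPlane_of_mem_graphSide hσ hx (hsub hτ)
  have hne (τ : ℝ) (hτ : τ ∈ Ioo A B) : τ ≠ s := by
    rintro rfl
    simpa [h.chart_self] using hpos τ hτ
  rw [← intervalIntegral.integral_const_mul]
  refine integral_eq_arg_sub_arg (f' := C.chartDeriv a s) hAB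
    (fun τ hτ => h.continuousAt_chart (hsub hτ))
    (fun τ hτ => h.hasDerivAt_chart (hsub (Ioo_subset_Icc_self hτ)) (hne τ hτ)) hslit
    (fun τ hτ => Or.inl (by rw [Complex.re_ofReal_mul]; exact hpos τ hτ)) (fun τ hτ => ?_)
    (((C.intervalIntegrable_kernel x A B).sub
      (C.intervalIntegrable_kernel (C.path s) A B)).const_mul _) hα hβ
  exact h.two_pi_mul_kernel_sub_kernel hxs (hsub (Ioo_subset_Icc_self hτ)) (hne τ hτ)
    (sub_ne_zero.1 (right_ne_zero_of_mul
      (Complex.slitPlane_ne_zero (hslit τ (Ioo_subset_Icc_self hτ)))))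

theorem continuousAt_arg_mul_chart {ε : ℝ} (hτ : τ ∈ Icc (s - η) (s + η))
    (hpos : 0 < ε * (C.chart a s τ).re) :
    ContinuousAt (fun τ => (ε * C.chart a s τ).arg) τ :=
  ContinuousAt.comp (g := Complex.arg) (Complex.continuousAt_arg (Or.inl (by simpa using hpos)))
    (continuousAt_const.mul (h.continuousAt_chart hτ))

theorem integral_kernel_sub_kernel_eq (hσ : σ ≠ 0) (hxs : 1 + ⟪(x : E3), C.path s⟫ ≠ 0)
    (hx : x ∈ C.graphSide s a η σ) :
    2 * Real.pi * ∫ τ in (s - η)..(s + η), (C.kernel x τ - C.kernel (C.path s) τ) =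
      (frameCoord a (C.path s) (C.rightDeriv s)).arg -
          (frameCoord a (C.path s) (C.leftDeriv s)).arg +
        ((σ * Complex.I * (C.chart a s (s + η) - stereo a (C.path s) x)).arg -
          (((1 : ℝ) : ℂ) * C.chart a s (s + η)).arg) -
        ((σ * Complex.I * (C.chart a s (s - η) - stereo a (C.path s) x)).arg -
          (((-1 : ℝ) : ℂ) * C.chart a s (s - η)).arg) := by
  have hη := h.pos
  have hint (A B : ℝ) :=
    (C.intervalIntegrable_kernel x A B).sub (C.intervalIntegrable_kernel (C.path s) A B)
  have hposR (τ : ℝ) (hτ : τ ∈ Ioc s (s + η)) : 0 < 1 * (C.chart a s τ).re := by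
    rw [one_mul]
    exact h.chart_re_pos hτ
  have hposL (τ : ℝ) (hτ : τ ∈ Ico (s - η) s) : 0 < -1 * (C.chart a s τ).re := by
    rw [neg_one_mul, neg_pos]
    exact h.chart_re_neg hτ
  have hright := h.integral_kernel_sub_kernel hσ hxs hx (lt_add_of_pos_right s hη)
    (Icc_subset_Icc_left (by linarith)) (fun τ hτ => hposR τ (Ioo_subset_Ioc_self hτ))
    h.tendsto_arg_chart_right
    ((h.continuousAt_arg_mul_chart (right_mem_Icc.2 (by linarith))
      (hposR _ (right_mem_Ioc.2 (by linarith)))).tendsto.mono_left nhdsWithin_le_nhds)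
  have hleft := h.integral_kernel_sub_kernel hσ hxs hx (sub_lt_self s hη)
    (Icc_subset_Icc_right (by linarith)) (fun τ hτ => hposL τ (Ioo_subset_Ico_self hτ))
    ((h.continuousAt_arg_mul_chart (left_mem_Icc.2 (by linarith))
      (hposL _ (left_mem_Ico.2 (by linarith)))).tendsto.mono_left nhdsWithin_le_nhds)
    h.tendsto_arg_chart_left
  rw [← intervalIntegral.integral_add_adjacent_intervals (hint (s - η) s) (hint s (s + η)),
    mul_add, hleft, hright]
  ring

theorem tendsto_arg_mul_sub_stereo (hσ : σ ≠ 0) {z : ℂ} (hz : z.re ≠ 0) :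
    Tendsto (fun x : Sphere2 => (σ * Complex.I * (z - stereo a (C.path s) x)).arg) (𝓝 (C.pt s))
      (𝓝 (σ * Complex.I * z).arg) := by
  have hslit : σ * Complex.I * z ∈ Complex.slitPlane := by
    refine Or.inr ?_
    rw [mul_assoc, Complex.im_ofReal_mul, Complex.I_mul_im]
    exact mul_ne_zero hσ hz
  refine (Complex.continuousAt_arg hslit).tendsto.comp ?_
  simpa using (h.tendsto_stereo.const_sub z).const_mul (σ * Complex.I)

theorem tendsto_integral_kernel_sub_kernel (hσ : σ = 1 ∨ σ = -1) {D : Set Sphere2}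
    (hD : ∀ᶠ x in 𝓝[D] C.pt s, x ∈ C.graphSide s a η σ) :
    Tendsto (fun x : Sphere2 => ∫ τ in (s - η)..(s + η), (C.kernel x τ - C.kernel (C.path s) τ))
      (𝓝[D] C.pt s) (𝓝 (((frameCoord a (C.path s) (C.rightDeriv s)).arg -
        (frameCoord a (C.path s) (C.leftDeriv s)).arg + σ * Real.pi) / (2 * Real.pi))) := by
  have hη := h.pos
  have hσ0 : σ ≠ 0 := by rcases hσ with rfl | rfl <;> norm_num
  have hright := h.chart_re_pos (right_mem_Ioc.2 (by linarith))
  have hleft := h.chart_re_neg (left_mem_Ico.2 (by linarith))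
  have hlim := ((h.tendsto_arg_mul_sub_stereo hσ0 hright.ne').mono_left
    (nhdsWithin_le_nhds (s := D))).sub_const (((1 : ℝ) : ℂ) * C.chart a s (s + η)).arg
  have hlim' := ((h.tendsto_arg_mul_sub_stereo hσ0 hleft.ne).mono_left
    (nhdsWithin_le_nhds (s := D))).sub_const (((-1 : ℝ) : ℂ) * C.chart a s (s - η)).arg
  rw [arg_mul_I_mul_sub_arg hσ (Or.inl rfl) (by rwa [one_mul])] at hlim
  rw [arg_mul_I_mul_sub_arg hσ (Or.inr rfl) (by rwa [neg_one_mul, neg_pos])] at hlim'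
  have hjump (t : ℝ) : t + σ * Real.pi =
      t + σ * 1 * (Real.pi / 2) - σ * -1 * (Real.pi / 2) := by ring
  rw [hjump]
  refine (((hlim.const_add _).sub hlim').div_const _).congr' ?_
  filter_upwards [hD, nhdsWithin_le_nhds (continuous_subtype_val.continuousAt.eventually
    (eventually_one_add_inner_pos s))] with x hx hxs
  rw [← h.integral_kernel_sub_kernel_eq hσ0 hxs.ne' hx,
    mul_div_cancel_left₀ _ (by positivity)]

end IsLocalGraph
end SphereCurve

/-! ### The interior angle -/

namespace SphereCurve

variable {C : SphereCurve} {s : ℝ} {a : E3}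

namespace IsTransversal

variable (h : C.IsTransversal s a)
include h

theorem interiorAngle_eq_toIcoMod_arg :
    C.interiorAngle s = toIcoMod Real.two_pi_pos 0
      (-(conj (frameCoord a (C.path s) (C.rightDeriv s)) *
        frameCoord a (C.path s) (C.leftDeriv s))).arg := by
  have hR := norm_pos_iff.2 (C.rightDeriv_ne_zero s)
  have hL := norm_pos_iff.2 (C.leftDeriv_ne_zero s)
  have horth : ⟪C.rightDeriv s, C.path s⟫ = 0 := by
    rw [real_inner_comm, C.inner_path_rightDeriv]
  have hrotate := inner_cross_rotate (C.path s) (C.rightDeriv s) (C.leftDeriv s)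
  rw [← Complex.arg_real_mul _ (mul_pos (inv_pos.2 hR) (inv_pos.2 hL)), interiorAngle,
    rightTangent_eq, leftTangent_eq]
  congr 2
  apply Complex.ext
  · simp only [h.conj_frameCoord_mul, horth, Complex.re_ofReal_mul, Complex.neg_re, inner_neg_right,
      real_inner_smul_left, real_inner_smul_right]
    ring
  · simp only [h.conj_frameCoord_mul, Complex.im_ofReal_mul, Complex.neg_im, inner_neg_right,
      cross_smul_right, real_inner_smul_left, real_inner_smul_right, hrotate]
    ring

theorem interiorAngle_eq :
    C.interiorAngle s = Real.pi + (frameCoord a (C.path s) (C.leftDeriv s)).arg -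
      (frameCoord a (C.path s) (C.rightDeriv s)).arg := by
  have hF := abs_lt.1 (Complex.abs_arg_lt_pi_div_two_iff.2 (Or.inl h.frameCoord_rightDeriv_re_pos))
  have hG := abs_lt.1 (Complex.abs_arg_lt_pi_div_two_iff.2 (Or.inl h.frameCoord_leftDeriv_re_pos))
  have hF0 : frameCoord a (C.path s) (C.rightDeriv s) ≠ 0 := fun h0 => by
    simpa [h0] using h.frameCoord_rightDeriv_re_pos
  have hG0 : frameCoord a (C.path s) (C.leftDeriv s) ≠ 0 := fun h0 => by
    simpa [h0] using h.frameCoord_leftDeriv_re_pos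
  rw [h.interiorAngle_eq_toIcoMod_arg, toIcoMod_eq_iff]
  refine ⟨⟨by linarith, by linarith⟩, ?_⟩
  have hangle : ((-(conj (frameCoord a (C.path s) (C.rightDeriv s)) *
      frameCoord a (C.path s) (C.leftDeriv s))).arg : Real.Angle) =
        ((Real.pi + (frameCoord a (C.path s) (C.leftDeriv s)).arg -
          (frameCoord a (C.path s) (C.rightDeriv s)).arg : ℝ) : Real.Angle) := by
    rw [Complex.arg_neg_coe_angle (mul_ne_zero ((map_ne_zero _).2 hF0) hG0),
      Complex.arg_mul_coe_angle ((map_ne_zero _).2 hF0) hG0, Complex.arg_conj_coe_angle,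
      Real.Angle.coe_sub, Real.Angle.coe_add]
    abel
  obtain ⟨n, hn⟩ := Real.Angle.angle_eq_iff_two_pi_dvd_sub.1 hangle
  exact ⟨n, by rw [zsmul_eq_mul]; linarith⟩

end IsTransversal

theorem interiorAngle_eq_pi (ht : leftTangent C.path s = rightTangent C.path s) :
    C.interiorAngle s = Real.pi := by
  obtain ⟨a, h⟩ := C.exists_isTransversal s
  have hR := norm_pos_iff.2 (C.rightDeriv_ne_zero s)
  have hL := norm_pos_iff.2 (C.leftDeriv_ne_zero s)
  have hv : C.leftDeriv s = (‖C.leftDeriv s‖ * ‖C.rightDeriv s‖⁻¹) • C.rightDeriv s := by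
    rw [mul_smul, ← rightTangent_eq, ← ht, leftTangent_eq, smul_inv_smul₀ hL.ne']
  rw [h.interiorAngle_eq, hv, map_smul, Complex.real_smul, Complex.arg_real_mul _ (by positivity),
    add_sub_cancel_right]

end SphereCurve

/-! ### The two sides of the curve -/

section GraphOverRealAxis

variable {f g : ℝ → ℂ} {v w : ℂ} {A B τ₀ : ℝ}

theorem exists_re_eq_of_hasStrictDerivAt (hf : HasStrictDerivAt f v τ₀) (hg : HasDerivAt g w 0)
    (hfg : g 0 = f τ₀) (hv : v.re ≠ 0) :
    ∃ r : ℝ → ℝ, r 0 = τ₀ ∧ HasDerivAt r (v.re⁻¹ * w.re) 0 ∧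
      ∀ᶠ δ in 𝓝 (0 : ℝ), (f (r δ)).re = (g δ).re := by
  have hre : HasStrictDerivAt (fun τ => (f τ).re) v.re τ₀ :=
    Complex.reCLM.hasStrictFDerivAt.comp_hasStrictDerivAt τ₀ hf
  have hgre : HasDerivAt (fun δ => (g δ).re) w.re 0 :=
    Complex.reCLM.hasFDerivAt.comp_hasDerivAt 0 hg
  have hg0 : (g 0).re = (f τ₀).re := congrArg Complex.re hfg
  have hinv : HasDerivAt (hre.localInverse _ _ _ hv) v.re⁻¹ (g 0).re :=
    hg0 ▸ (hre.to_localInverse hv).hasDerivAt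
  refine ⟨fun δ => hre.localInverse _ _ _ hv (g δ).re, ?_, hinv.comp 0 hgre, ?_⟩
  · simp only [hg0]
    exact (hre.hasStrictFDerivAt_equiv hv).localInverse_apply_image
  · exact hgre.continuousAt.eventually (hg0 ▸ hre.eventually_right_inverse hv)

theorem eventually_lt_of_hasDerivAt_pos {f : ℝ → ℝ} {f' x : ℝ} (hf : HasDerivAt f f' x)
    (hf' : 0 < f') : ∀ᶠ y in 𝓝[>] x, f x < f y := by
  have hslope := (hasDerivAt_iff_tendsto_slope.1 hf).mono_left
    (nhdsWithin_mono x fun y (hy : x < y) => hy.ne')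
  filter_upwards [hslope.eventually_const_lt hf', self_mem_nhdsWithin] with y hy hxy
  rw [slope_def_field] at hy
  exact sub_pos.1 ((div_pos_iff_of_pos_right (sub_pos.2 hxy)).1 hy)

/-- The hypothesis `0 < (conj v * w).im` says that `g` leaves the graph to the left. -/
theorem eventually_im_lt_im_of_hasDerivAt (hmono : StrictMonoOn (fun τ => (f τ).re) (Icc A B))
    (hτ₀ : τ₀ ∈ Ioo A B) (hf : HasStrictDerivAt f v τ₀) (hg : HasDerivAt g w 0)
    (hfg : g 0 = f τ₀) (hv : 0 < v.re) (hvw : 0 < (conj v * w).im) :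
    ∀ᶠ δ in 𝓝[>] (0 : ℝ), ∀ τ ∈ Icc A B, (f τ).re = (g δ).re → (f τ).im < (g δ).im := by
  obtain ⟨r, hr0, hr, hfr⟩ := exists_re_eq_of_hasStrictDerivAt hf hg hfg hv.ne'
  have hfr' : HasDerivAt (fun δ => f (r δ)) ((v.re⁻¹ * w.re) • v) 0 :=
    HasDerivAt.scomp (g₁ := f) 0 (hr0 ▸ hf.hasDerivAt) hr
  have hgap : HasDerivAt (fun δ => (g δ).im - (f (r δ)).im) (v.re⁻¹ * (conj v * w).im) 0 := by
    refine ((Complex.imCLM.hasFDerivAt.comp_hasDerivAt 0 hg).sub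
      (Complex.imCLM.hasFDerivAt.comp_hasDerivAt 0 hfr')).congr_deriv ?_
    simp only [Complex.imCLM_apply, Complex.smul_im, smul_eq_mul, Complex.mul_im, Complex.conj_re,
      Complex.conj_im]
    field_simp
    ring
  have hmem : ∀ᶠ δ in 𝓝 (0 : ℝ), r δ ∈ Icc A B :=
    hr.continuousAt.eventually (hr0 ▸ Icc_mem_nhds hτ₀.1 hτ₀.2)
  filter_upwards [eventually_lt_of_hasDerivAt_pos hgap (by positivity), nhdsWithin_le_nhds hfr,
    nhdsWithin_le_nhds hmem] with δ hpos hδ hδr τ hτ hτδ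
  obtain rfl := hmono.injOn hτ hδr (hτδ.trans hδ.symm)
  rwa [hr0, hfg, sub_self, sub_pos] at hpos

end GraphOverRealAxis

namespace SphereCurve

theorem contDiffAt_chart {C : SphereCurve} {a : E3} {s τ : ℝ} (hd : ContDiffAt ℝ 2 C.path τ)
    (h : 1 + ⟪C.path τ, C.path s⟫ ≠ 0) : ContDiffAt ℝ 2 (C.chart a s) τ := by
  have hnum : ContDiffAt ℝ 2 (fun σ => frameCoord a (C.path s) (C.path σ)) τ :=
    (frameCoord a (C.path s)).contDiff.contDiffAt.comp τ hd
  have hdenom : ContDiffAt ℝ 2 (fun σ => ((1 + ⟪C.path σ, C.path s⟫ : ℝ) : ℂ)) τ :=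
    Complex.ofRealCLM.contDiff.contDiffAt.comp τ
      (contDiffAt_const.add (hd.inner ℝ contDiffAt_const))
  exact (hnum.mul (hdenom.inv (Complex.ofReal_ne_zero.2 h))).congr_of_eventuallyEq
    (Eventually.of_forall fun σ => div_eq_mul_inv _ _)

end SphereCurve

theorem stereoDeriv_smul (a c y v : E3) (r : ℝ) :
    stereoDeriv a c y (r • v) = r * stereoDeriv a c y v := by
  simp only [stereoDeriv, map_smul, real_inner_smul_left, Complex.real_smul, Complex.ofReal_mul]
  ring

namespace SphereCurve

variable {C : SphereCurve} {s η τ σ : ℝ} {a : E3} {S₁ S₂ : Set Sphere2}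

theorem eventually_mem_carrier_imp_mem_image (s : ℝ) (hη : 0 < η) :
    ∀ᶠ x in 𝓝 (C.pt s), x ∈ C.carrier → x ∈ C.pt '' Icc (s - η) (s + η) := by
  have hclosed : IsClosed (C.pt '' Icc (s + η) (s - η + C.N)) :=
    (isCompact_Icc.image C.continuous_pt).isClosed
  have hnotMem : C.pt s ∉ C.pt '' Icc (s + η) (s - η + C.N) := by
    rintro ⟨τ, hτ, hτs⟩
    exact path_ne_of_mem_Ioo (C := C) (s := s) ⟨by linarith [hτ.1], by linarith [hτ.2]⟩
      (congrArg Subtype.val hτs)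
  filter_upwards [hclosed.isOpen_compl.mem_nhds hnotMem] with x hx
  rintro ⟨τ, rfl⟩
  obtain ⟨τ', hτ', heq⟩ := C.periodic.exists_mem_Ico C.N_pos_real τ (s - η)
  rw [heq] at hx ⊢
  exact ⟨τ', ⟨hτ'.1, le_of_not_gt fun hlt => hx ⟨τ', ⟨hlt.le, hτ'.2.le⟩, rfl⟩⟩, rfl⟩

namespace IsLocalGraph

variable (h : C.IsLocalGraph s a η)
include h

theorem hasStrictDerivAt_chart (hτ : τ ∈ Icc (s - η) (s + η)) (hne : τ ≠ s) :
    HasStrictDerivAt (C.chart a s) (C.chartDeriv a s τ) τ :=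
  (contDiffAt_chart (h.contDiffAt τ hτ hne) (h.denom_pos τ hτ).ne').hasStrictDerivAt'
    (h.hasDerivAt_chart hτ hne) two_ne_zero

theorem conj_chartDeriv_mul_stereoDeriv_normal_im_pos (hτ : τ ∈ Icc (s - η) (s + η))
    (hne : τ ≠ s) :
    0 < (conj (C.chartDeriv a s τ) *
      stereoDeriv a (C.path s) (C.path τ) (cross (C.path τ) (C.tangent τ))).im := by
  have hpos := h.deriv_re_pos τ hτ hne
  have htangent : ⟪C.path τ, C.tangent τ⟫ = 0 := by
    rw [tangent, rightTangent_eq, real_inner_smul_right, inner_path_rightDeriv, mul_zero]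
  have hchart : C.chartDeriv a s τ =
      ‖deriv C.path τ‖ * stereoDeriv a (C.path s) (C.path τ) (C.tangent τ) := by
    rw [← stereoDeriv_smul, norm_deriv_smul_tangent, chartDeriv]
  rw [h.stereoDeriv_cross (C.norm_path τ) (h.denom_pos τ hτ).ne' htangent]
  rw [hchart, Complex.re_ofReal_mul] at hpos
  have hproduct (r : ℝ) (z : ℂ) :
      conj ((r : ℂ) * z) * (Complex.I * z) = Complex.I * ((r * Complex.normSq z : ℝ) : ℂ) := by
    rw [map_mul, Complex.conj_ofReal, Complex.ofReal_mul, Complex.normSq_eq_conj_mul_self]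
    ring
  rw [hchart, hproduct, Complex.I_mul_im, Complex.ofReal_re]
  have hre := pos_of_mul_pos_right hpos (norm_nonneg _)
  exact mul_pos ((pos_iff_pos_of_mul_pos hpos).2 hre)
    (Complex.normSq_pos.2 fun h0 => hre.ne' (by rw [h0, Complex.zero_re]))

theorem eventually_normal_mem_graphSide (hτ : τ ∈ Ioo (s - η) (s + η)) (hne : τ ≠ s) :
    ∀ᶠ δ in 𝓝[>] (0 : ℝ), ∀ z : Sphere2,
      (z : E3) = ‖C.path τ + δ • cross (C.path τ) (C.tangent τ)‖⁻¹ •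
        (C.path τ + δ • cross (C.path τ) (C.tangent τ)) → z ∈ C.graphSide s a η 1 := by
  have hτ' := Ioo_subset_Icc_self hτ
  have hzero : ‖C.path τ + (0 : ℝ) • cross (C.path τ) (C.tangent τ)‖⁻¹ •
      (C.path τ + (0 : ℝ) • cross (C.path τ) (C.tangent τ)) = C.path τ := by
    rw [zero_smul, add_zero, C.norm_path, inv_one, one_smul]
  have hnormal : HasDerivAt _ _ (0 : ℝ) := hasDerivAt_normalize_add_smul (C.norm_path τ)
    (n := cross (C.path τ) (C.tangent τ)) (by rw [real_inner_comm, inner_cross_left_self])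
  have hg := (hasDerivWithinAt_stereo a (C.path s) hnormal.hasDerivWithinAt (S := univ)
    (by rw [hzero]; exact (h.denom_pos τ hτ').ne')).hasDerivAt univ_mem
  rw [hzero] at hg
  filter_upwards [eventually_im_lt_im_of_hasDerivAt h.strictMonoOn_chart_re hτ
    (h.hasStrictDerivAt_chart hτ' hne) hg (by rw [hzero, chart]) (h.deriv_re_pos τ hτ' hne)
    (h.conj_chartDeriv_mul_stereoDeriv_normal_im_pos hτ' hne)] with δ hδ z hz σ hσ hre
  rw [hz] at hre ⊢
  rw [one_mul, sub_pos]
  exact hδ σ hσ hre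

theorem exists_mem_inter_graphSide (hor : C.PositivelyOriented S₂) {U : Set Sphere2}
    (hU : U ∈ 𝓝 (C.pt s)) : ∃ z ∈ U, z ∈ S₂ ∧ z ∈ C.graphSide s a η 1 := by
  obtain ⟨k, hk⟩ := exists_mem_Ico_arc s
  have hnear : ∀ᶠ τ in 𝓝[>] s, U ∈ 𝓝 (C.pt τ) :=
    nhdsWithin_le_nhds (C.continuous_pt.continuousAt.eventually (eventually_mem_nhds_iff.2 hU))
  have harc : ∀ᶠ τ in 𝓝[>] s, τ ∈ Ioo s (k + 1 : ℝ) := Ioo_mem_nhdsGT hk.2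
  have hgraph : ∀ᶠ τ in 𝓝[>] s, τ ∈ Ioo s (s + η) := Ioo_mem_nhdsGT (lt_add_of_pos_right s h.pos)
  obtain ⟨τ, hτU, hτk, hτη⟩ := (hnear.and (harc.and hgraph)).exists
  have hτ : ∀ j : ℤ, τ ≠ j := by
    rintro j rfl
    have hkj : (k : ℝ) < j := hk.1.trans_lt hτk.1
    have hjk : (j : ℝ) < k + 1 := hτk.2
    norm_cast at hkj hjk
    omega
  obtain ⟨V, hV, hVU⟩ := (mem_nhds_subtype _ _ _).1 hτU
  have hnormal := (hasDerivAt_normalize_add_smul (C.norm_path τ)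
    (n := cross (C.path τ) (C.tangent τ))
    (by rw [real_inner_comm, inner_cross_left_self])).continuousAt
  have hVnormal := hnormal.eventually_mem (s := V) (by simpa [C.norm_path] using! hV)
  obtain ⟨δ, ⟨z, hzS, hz⟩, hδ, hδV⟩ := ((hor τ hτ).and ((h.eventually_normal_mem_graphSide
    ⟨by linarith [h.pos, hτη.1], hτη.2⟩ hτη.1.ne').and (nhdsWithin_le_nhds hVnormal))).exists
  refine ⟨z, hVU ?_, hzS, hδ z hz⟩
  rw [mem_preimage, hz]
  exact hδV

end IsLocalGraph

end SphereCurve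

namespace SphereCurve

variable {C : SphereCurve} {s η τ σ : ℝ} {a : E3} {S₁ S₂ : Set Sphere2} {p : ℝ × ℝ}

/-- The point of the sphere that lies at the height `p.2` above the point of the curve with
parameter `p.1`, in the chart centred at the point with parameter `s`. For a local graph these are
coordinates of the sphere that straighten the curve to the line `p.2 = 0`. -/
def IsTransversal.verticalShift (h : C.IsTransversal s a) (p : ℝ × ℝ) : Sphere2 :=
  ⟨stereoInv a (C.path s) (C.chart a s p.1 + p.2 * Complex.I),
    mem_sphere_zero_iff_norm.2 (h.norm_stereoInv _)⟩

namespace Divides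

theorem disjoint_fst_carrier (hdiv : C.Divides S₁ S₂) : Disjoint S₁ C.carrier :=
  subset_compl_iff_disjoint_right.1 (subset_union_left.trans hdiv.union_eq.subset)

theorem disjoint_snd_carrier (hdiv : C.Divides S₁ S₂) : Disjoint S₂ C.carrier :=
  subset_compl_iff_disjoint_right.1 (subset_union_right.trans hdiv.union_eq.subset)

end Divides

namespace IsLocalGraph

variable (h : C.IsLocalGraph s a η)
include h

theorem stereo_verticalShift (p : ℝ × ℝ) :
    stereo a (C.path s) (h.verticalShift p) = C.chart a s p.1 + p.2 * Complex.I :=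
  h.stereo_stereoInv _

theorem verticalShift_zero (hτ : τ ∈ Icc (s - η) (s + η)) : h.verticalShift (τ, 0) = C.pt τ := by
  refine Subtype.ext ?_
  simp only [IsTransversal.verticalShift, Complex.ofReal_zero, zero_mul, add_zero]
  exact h.stereoInv_stereo (C.norm_path τ) (h.denom_pos τ hτ).ne'

theorem verticalShift_eq_of_re_eq {x : Sphere2} (hx : 0 < 1 + ⟪(x : E3), C.path s⟫)
    (hre : (C.chart a s τ).re = (stereo a (C.path s) x).re) :
    h.verticalShift (τ, (stereo a (C.path s) x).im - (C.chart a s τ).im) = x := by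
  have hpoint : C.chart a s τ + (((stereo a (C.path s) x).im - (C.chart a s τ).im : ℝ) : ℂ) *
      Complex.I = stereo a (C.path s) x := by
    apply Complex.ext <;> simp [hre]
  refine Subtype.ext ?_
  simp only [IsTransversal.verticalShift, hpoint]
  exact h.stereoInv_stereo (norm_eq_of_mem_sphere x) hx.ne'

theorem verticalShift_mem_graphSide_iff (hp : p.1 ∈ Icc (s - η) (s + η)) :
    h.verticalShift p ∈ C.graphSide s a η σ ↔ 0 < σ * p.2 := by
  simp only [graphSide, mem_ofPred_eq, h.stereo_verticalShift, Complex.add_re, Complex.add_im,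
    Complex.re_ofReal_mul, Complex.im_ofReal_mul, Complex.I_re, Complex.I_im, mul_zero, mul_one,
    add_zero]
  refine ⟨fun hside => by simpa using hside p.1 hp rfl, fun hpos τ hτ hre => ?_⟩
  rwa [h.strictMonoOn_chart_re.injOn hτ hp hre, add_sub_cancel_left]

theorem continuousAt_verticalShift (hp : p.1 ∈ Icc (s - η) (s + η)) :
    ContinuousAt h.verticalShift p := by
  have hchart : ContinuousAt (fun q : ℝ × ℝ => C.chart a s q.1) p :=
    ContinuousAt.comp (g := C.chart a s) (h.continuousAt_chart hp) continuousAt_fst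
  refine IsInducing.subtypeVal.continuousAt_iff.2
    ((continuous_stereoInv a (C.path s)).continuousAt.comp ?_)
  exact hchart.add (by fun_prop)

theorem eventually_fst_mem_Icc :
    ∀ᶠ p : ℝ × ℝ in 𝓝 (s, (0 : ℝ)), p.1 ∈ Icc (s - η) (s + η) :=
  continuousAt_fst.eventually_mem (Icc_mem_nhds (by linarith [h.pos]) (by linarith [h.pos]))

theorem eventually_snd_eq_zero_of_verticalShift_mem_carrier :
    ∀ᶠ p in 𝓝 (s, (0 : ℝ)), h.verticalShift p ∈ C.carrier → p.2 = 0 := by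
  have hcont := h.continuousAt_verticalShift (p := (s, 0)) h.self_mem_Icc
  have hnear := hcont.eventually (p := fun x => x ∈ C.carrier → x ∈ C.pt '' Icc (s - η) (s + η)) (by
    rw [h.verticalShift_zero h.self_mem_Icc]
    exact eventually_mem_carrier_imp_mem_image s h.pos)
  filter_upwards [h.eventually_fst_mem_Icc, hnear] with p hp hmem hcarrier
  obtain ⟨τ, hτ, hτp⟩ := hmem hcarrier
  rw [← h.verticalShift_zero hτ] at hτp
  have hside (σ : ℝ) : 0 < σ * 0 ↔ 0 < σ * p.2 := by
    rw [← h.verticalShift_mem_graphSide_iff hp, ← hτp, h.verticalShift_mem_graphSide_iff hτ]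
  simpa [mul_self_pos] using hside p.2

theorem eventually_exists_chart_re_eq {δ : ℝ} (hδ : δ ∈ Ioc 0 η) :
    ∀ᶠ x : Sphere2 in 𝓝 (C.pt s), ∃ τ ∈ Icc (s - δ) (s + δ),
      (C.chart a s τ).re = (stereo a (C.path s) x).re := by
  obtain ⟨hδ, hδη⟩ := hδ
  have hcont : ContinuousOn (fun τ => (C.chart a s τ).re) (Icc (s - δ) (s + δ)) := fun τ hτ =>
    (Complex.continuous_re.continuousAt.comp (h.continuousAt_chart
      ⟨by linarith [hτ.1], by linarith [hτ.2]⟩)).continuousWithinAt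
  have hre := ((Complex.continuous_re.tendsto _).comp h.tendsto_stereo).eventually_mem
    (Icc_mem_nhds (h.chart_re_neg (τ := s - δ) ⟨by linarith, by linarith⟩)
      (h.chart_re_pos (τ := s + δ) ⟨by linarith, by linarith⟩))
  filter_upwards [hre] with x hx
  exact intermediate_value_Icc (by linarith) hcont hx

theorem nhds_le_map_verticalShift : 𝓝 (C.pt s) ≤ map h.verticalShift (𝓝 (s, 0)) := by
  intro U hU
  obtain ⟨ε, hε, hball⟩ := Metric.mem_nhds_iff.1 (mem_map.1 hU)
  have him : ∀ᶠ τ in 𝓝 s, |(C.chart a s τ).im| < ε / 2 := by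
    refine ((Complex.continuous_im.continuousAt.comp
      (h.continuousAt_chart h.self_mem_Icc)).abs).eventually_lt_const ?_
    simpa [h.chart_self] using hε
  have him' : ∀ᶠ x : Sphere2 in 𝓝 (C.pt s), |(stereo a (C.path s) x).im| < ε / 2 := by
    refine ((Complex.continuous_im.tendsto _).comp h.tendsto_stereo).abs.eventually_lt_const ?_
    simpa using hε
  have hsmall : ∀ᶠ δ in 𝓝[>] (0 : ℝ), δ ∈ Ioo 0 (min η ε) := Ioo_mem_nhdsGT (lt_min h.pos hε)
  obtain ⟨δ, hδim, hδ, hδmin⟩ := ((eventually_forall_mem_Icc_sub_add him).and hsmall).exists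
  obtain ⟨hδη, hδε⟩ := lt_min_iff.1 hδmin
  filter_upwards [h.eventually_exists_chart_re_eq ⟨hδ, hδη.le⟩, him',
    continuous_subtype_val.continuousAt.eventually (eventually_one_add_inner_pos s)]
    with x ⟨τ, hτ, hτx⟩ hxim hx
  rw [← h.verticalShift_eq_of_re_eq hx hτx]
  refine hball ?_
  rw [Metric.mem_ball, Prod.dist_eq, max_lt_iff, Real.dist_eq, Real.dist_eq, sub_zero, abs_lt]
  exact ⟨⟨by linarith [hτ.1], by linarith [hτ.2]⟩,
    (abs_sub _ _).trans_lt (by linarith [hδim τ hτ])⟩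

theorem snd_ne_zero_of_verticalShift_notMem (hp : p.1 ∈ Icc (s - η) (s + η))
    (hmem : h.verticalShift p ∉ C.carrier) : p.2 ≠ 0 := fun h0 => by
  rw [← Prod.mk.eta (p := p), h0, h.verticalShift_zero hp] at hmem
  exact hmem (mem_range_self _)

theorem eventually_verticalShift_mem_or (hdiv : C.Divides S₁ S₂) (σ : ℝ) :
    (∀ᶠ p in 𝓝 (s, (0 : ℝ)), 0 < σ * p.2 → h.verticalShift p ∈ S₁) ∨
      ∀ᶠ p in 𝓝 (s, (0 : ℝ)), 0 < σ * p.2 → h.verticalShift p ∈ S₂ := by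
  obtain ⟨ρ, hρ, hB⟩ := Metric.eventually_nhds_iff_ball.1
    (h.eventually_fst_mem_Icc.and h.eventually_snd_eq_zero_of_verticalShift_mem_carrier)
  have hconvex : Convex ℝ (Metric.ball (s, (0 : ℝ)) ρ ∩ {p | 0 < σ * p.2}) :=
    (convex_ball _ _).inter (convex_halfSpace_gt (σ • LinearMap.snd ℝ ℝ ℝ).isLinear 0)
  have hpre : IsPreconnected
      (h.verticalShift '' (Metric.ball (s, (0 : ℝ)) ρ ∩ {p | 0 < σ * p.2})) :=
    hconvex.isPreconnected.image _ fun p hp =>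
      (h.continuousAt_verticalShift (hB p hp.1).1).continuousWithinAt
  have hsub : h.verticalShift '' (Metric.ball (s, (0 : ℝ)) ρ ∩ {p | 0 < σ * p.2}) ⊆ S₁ ∪ S₂ := by
    rintro _ ⟨p, ⟨hp, hpos⟩, rfl⟩
    exact hdiv.union_eq.superset fun hmem => right_ne_zero_of_mul hpos.ne' ((hB p hp).2 hmem)
  refine (hpre.subset_or_subset hdiv.isOpen_fst hdiv.isOpen_snd hdiv.disjoint hsub).imp ?_ ?_
  all_goals
    intro hS
    filter_upwards [Metric.ball_mem_nhds (s, (0 : ℝ)) hρ] with p hp hpos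
    exact hS (mem_image_of_mem _ ⟨hp, hpos⟩)

theorem eventually_verticalShift_mem_snd (hdiv : C.Divides S₁ S₂) (hor : C.PositivelyOriented S₂) :
    ∀ᶠ p in 𝓝 (s, (0 : ℝ)), 0 < p.2 → h.verticalShift p ∈ S₂ := by
  have hside := h.eventually_verticalShift_mem_or hdiv 1
  simp only [one_mul] at hside
  refine hside.resolve_left fun hS₁ => ?_
  obtain ⟨_, ⟨p, ⟨hp, hpS₁⟩, rfl⟩, hpS₂, hpside⟩ := h.exists_mem_inter_graphSide hor
    (h.nhds_le_map_verticalShift (image_mem_map (h.eventually_fst_mem_Icc.and hS₁)))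
  rw [h.verticalShift_mem_graphSide_iff hp, one_mul] at hpside
  exact disjoint_left.1 hdiv.disjoint (hpS₁ hpside) hpS₂

theorem eventually_verticalShift_mem_fst (hdiv : C.Divides S₁ S₂) (hor : C.PositivelyOriented S₂) :
    ∀ᶠ p in 𝓝 (s, (0 : ℝ)), p.2 < 0 → h.verticalShift p ∈ S₁ := by
  have hside := h.eventually_verticalShift_mem_or hdiv (-1)
  simp only [neg_one_mul, neg_pos] at hside
  refine hside.resolve_right fun hlower => ?_
  have hclosure : C.pt s ∈ closure S₁ :=
    frontier_subset_closure (hdiv.frontier_fst.superset (mem_range_self s))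
  obtain ⟨_, ⟨p, ⟨hp, hneg, hpos⟩, rfl⟩, hpS₁⟩ := mem_closure_iff_nhds.1 hclosure _
    (h.nhds_le_map_verticalShift (image_mem_map (h.eventually_fst_mem_Icc.and
      (hlower.and (h.eventually_verticalShift_mem_snd hdiv hor)))))
  have hpS₂ : h.verticalShift p ∈ S₂ :=
    (h.snd_ne_zero_of_verticalShift_notMem hp
      (disjoint_left.1 hdiv.disjoint_fst_carrier hpS₁)).lt_or_gt.elim hneg hpos
  exact disjoint_left.1 hdiv.disjoint hpS₁ hpS₂

theorem eventually_mem_graphSide_of_eventually_verticalShift {S : Set Sphere2}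
    (hS : ∀ᶠ p in 𝓝 (s, (0 : ℝ)), h.verticalShift p ∈ S → 0 < σ * p.2) :
    ∀ᶠ x in 𝓝[S] C.pt s, x ∈ C.graphSide s a η σ := by
  refine eventually_nhdsWithin_iff.2 (h.nhds_le_map_verticalShift ?_)
  exact (h.eventually_fst_mem_Icc.and hS).mono fun p hp hmem =>
    (h.verticalShift_mem_graphSide_iff hp.1).2 (hp.2 hmem)

theorem eventually_mem_graphSide_snd (hdiv : C.Divides S₁ S₂) (hor : C.PositivelyOriented S₂) :
    ∀ᶠ x in 𝓝[S₂] C.pt s, x ∈ C.graphSide s a η 1 := by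
  refine h.eventually_mem_graphSide_of_eventually_verticalShift ?_
  filter_upwards [h.eventually_fst_mem_Icc, h.eventually_verticalShift_mem_fst hdiv hor]
    with p hp hneg hpS₂
  rw [one_mul]
  refine (h.snd_ne_zero_of_verticalShift_notMem hp
    (disjoint_left.1 hdiv.disjoint_snd_carrier hpS₂)).lt_or_gt.resolve_left fun hlt => ?_
  exact disjoint_left.1 hdiv.disjoint (hneg hlt) hpS₂

theorem eventually_mem_graphSide_fst (hdiv : C.Divides S₁ S₂) (hor : C.PositivelyOriented S₂) :
    ∀ᶠ x in 𝓝[S₁] C.pt s, x ∈ C.graphSide s a η (-1) := by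
  refine h.eventually_mem_graphSide_of_eventually_verticalShift ?_
  filter_upwards [h.eventually_fst_mem_Icc, h.eventually_verticalShift_mem_snd hdiv hor]
    with p hp hpos hpS₁
  rw [neg_one_mul, neg_pos]
  refine (h.snd_ne_zero_of_verticalShift_notMem hp
    (disjoint_left.1 hdiv.disjoint_fst_carrier hpS₁)).lt_or_gt.resolve_right fun hgt => ?_
  exact disjoint_left.1 hdiv.disjoint hpS₁ (hpos hgt)

end IsLocalGraph

theorem tendsto_doubleLayer_snd {μ : Sphere2 → ℝ} (hμ : ContinuousOn μ C.carrier)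
    (hdiv : C.Divides S₁ S₂) (hor : C.PositivelyOriented S₂) (s : ℝ) :
    Tendsto (C.doubleLayer C.tangent μ) (𝓝[S₂] (C.pt s))
      (𝓝 ((∫ τ in (0 : ℝ)..C.N, μ (C.pt τ) * C.kernel (C.path s) τ) +
        (1 - C.interiorAngle s / (2 * Real.pi)) * μ (C.pt s))) := by
  obtain ⟨a, ha⟩ := C.exists_isTransversal s
  refine tendsto_doubleLayer hμ hdiv.disjoint_snd_carrier ?_
  filter_upwards [ha.eventually_isLocalGraph] with η h
  convert h.tendsto_integral_kernel_sub_kernel (Or.inl rfl)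
    (h.eventually_mem_graphSide_snd hdiv hor) using 2
  rw [ha.interiorAngle_eq]
  field_simp
  ring

theorem tendsto_doubleLayer_fst {μ : Sphere2 → ℝ} (hμ : ContinuousOn μ C.carrier)
    (hdiv : C.Divides S₁ S₂) (hor : C.PositivelyOriented S₂) (s : ℝ) :
    Tendsto (C.doubleLayer C.tangent μ) (𝓝[S₁] (C.pt s))
      (𝓝 ((∫ τ in (0 : ℝ)..C.N, μ (C.pt τ) * C.kernel (C.path s) τ) +
        -(C.interiorAngle s / (2 * Real.pi)) * μ (C.pt s))) := by
  obtain ⟨a, ha⟩ := C.exists_isTransversal s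
  refine tendsto_doubleLayer hμ hdiv.disjoint_fst_carrier ?_
  filter_upwards [ha.eventually_isLocalGraph] with η h
  convert h.tendsto_integral_kernel_sub_kernel (Or.inr rfl)
    (h.eventually_mem_graphSide_fst hdiv hor) using 2
  rw [ha.interiorAngle_eq]
  field_simp
  ring

end SphereCurve

end

/-- The trace from `S₂` is formed with the unit tangent `t` oriented in accordance with `S₂`, the
trace from `S₁` with the opposite unit tangent `-t`, which is oriented in accordance with `S₁`. -/
theorem mainTheorem3 (C : SphereCurve) (S₁ S₂ : Set Sphere2)
    (hdiv : C.Divides S₁ S₂) (hor : C.PositivelyOriented S₂)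
    (μ : Sphere2 → ℝ) (hμ : ContinuousOn μ C.carrier) (s : ℝ) :
    Tendsto (C.truncK C.tangent μ (C.pt s)) (𝓝[>] 0) (𝓝 (C.K C.tangent μ (C.pt s))) ∧
    Tendsto (C.doubleLayer C.tangent μ) (𝓝[S₂] (C.pt s))
      (𝓝 (trace S₂ (C.doubleLayer C.tangent μ) (C.pt s))) ∧
    trace S₂ (C.doubleLayer C.tangent μ) (C.pt s) =
      C.K C.tangent μ (C.pt s) + (1 - C.interiorAngle s / (2 * Real.pi)) * μ (C.pt s) ∧
    (leftTangent C.path s = rightTangent C.path s → C.interiorAngle s = Real.pi) ∧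
    Tendsto (C.doubleLayer (-C.tangent) μ) (𝓝[S₁] (C.pt s))
      (𝓝 (trace S₁ (C.doubleLayer (-C.tangent) μ) (C.pt s))) ∧
    trace S₂ (C.doubleLayer C.tangent μ) (C.pt s) +
      trace S₁ (C.doubleLayer (-C.tangent) μ) (C.pt s) = μ (C.pt s) := by
  have : (𝓝[S₁] (C.pt s)).NeBot := mem_closure_iff_nhdsWithin_neBot.1
    (frontier_subset_closure (hdiv.frontier_fst.superset (mem_range_self s)))
  have : (𝓝[S₂] (C.pt s)).NeBot := mem_closure_iff_nhdsWithin_neBot.1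
    (frontier_subset_closure (hdiv.frontier_snd.superset (mem_range_self s)))
  have htrunc := SphereCurve.tendsto_truncK hμ s
  have hsnd := SphereCurve.tendsto_doubleLayer_snd hμ hdiv hor s
  have hfst : Tendsto (C.doubleLayer (-C.tangent) μ) (𝓝[S₁] (C.pt s)) _ :=
    (SphereCurve.tendsto_doubleLayer_fst hμ hdiv hor s).neg.congr fun x =>
      (SphereCurve.doubleLayer_neg C.tangent μ x).symm
  rw [SphereCurve.K, trace, trace, htrunc.limUnder_eq, hsnd.limUnder_eq, hfst.limUnder_eq]
  refine ⟨htrunc, hsnd, rfl, SphereCurve.interiorAngle_eq_pi, hfst, ?_⟩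
  ring
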